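/- **Theorem.** Let $N\ge 2$ and $n=N-1$. *Setting and notation.* Let $\mathcal A$ be a commutative $*$-algebra over $\mathbb C$ (not necessarily unital; conjugation is written $\bar f$) with a derivation $D_x$ that commutes with conjugation and has trivial kernel (for example the differential polynomials without constant term in $\vec v,\bar{\vec v},\vec v_x,\bar{\vec v}_x,\dots$, possibly extended by nonlocal variables). Thus $D_x^{-1}$ is defined and single-valued on $D_x\mathcal A$, and all operators below are partially defined, on those vectors for which the $D_x^{-1}$'s in them exist. Let $\vec v\in\mathcal A^{n}$ (row vectors). For row vectors put $\vec A\otimes\vec B=\vec A^{T}\vec B$, $\vec A\wedge^\dagger\vec B=\vec A\otimes\vec B-\bar{\vec B}\otimes\bar{\vec A}$, $\vec A\odot^\dagger\vec B=\vec A\otimes\vec B+\bar{\vec B}\otimes\bar{\vec A}$, $\vec A\cdot^\dagger\vec B=\tfrac12(\vec A\cdot\vec B+\bar{\vec B}\cdot\bar{\vec A})$, and let $\vec v\lrcorner M=\vec vM$ for a matrix $M$. Define $$\mathcal H=D_x-2\mathrm i\,D_x^{-1}(\bar{\vec v}\cdot^\dagger\mathrm i\;\,)\,\vec v+\vec v\lrcorner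 D_x^{-1}(\bar{\vec v}\wedge^\dagger\;),\qquad \mathcal I=\mathrm i,\qquad \mathcal J=D_x+2D_x^{-1}(\bar{\vec v}\cdot^\dagger\;)\,\vec v+\vec v\lrcorner D_x^{-1}(\bar{\vec v}\odot^\dagger\;).$$ Write $f\sim 0$ if $f\in D_x\mathcal A$, and $\langle\vec a,\vec b\rangle=\bar{\vec a}\cdot^\dagger\vec b$. A vector field is a derivation $X$ of $\mathcal A$ commuting with $D_x$ and with conjugation; its characteristic is $X\vec v$, and $[X,Y]$ has characteristic $X(Y\vec v)-Y(X\vec v)$. An operator $T$ (partially defined, real-linear) is *skew-adjoint* if $\langle\vec a,T\vec b\rangle+\langle\vec b,T\vec a\rangle\sim0$ on its domain. It is *cosymplectic* if it is skew-adjoint and $\langle\vec a,T'[T\vec b]\vec c\rangle+\text{cyclic}\sim0$ for all $\vec a,\vec b,\vec c$ in its domain whose images are characteristics of vector fields, where, with $B$ a vector field of characteristic $T\vec b$, $T'[T\vec b]\vec c=B(T\vec c)-T(B\vec c)$ and $-\langle\vec a,T(B\vec c)\rangle$ is read as $\langle T\vec a,B\vec c\rangle$. It is *symplectic* if it is skew-adjoint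 and the 2-form $\omega(Y,Z)=\langle Y\vec v,T(Z\vec v)\rangle$ is closed modulo $D_x\mathcal A$. It is *hereditary* if $[TX,TY]=T([TX,Y]+[X,TY]-T[X,Y])$ for all vector fields $X,Y$ in its domain such that $TX,TY$ are vector fields (all terms being defined). Two cosymplectic operators are a *Hamiltonian pair* if all their real linear combinations are cosymplectic; two symplectic operators $S,T$ are *compatible* if all their real linear combinations are symplectic and $T^{-1}S$ is hereditary. *Operators.* $\mathcal H$ and $\mathcal I$ are a Hamiltonian pair of $U(N-1)$-invariant cosymplectic operators, where invariance means equivariance under $(\vec v,\vec a)\mapsto(\vec vU,\vec aU)$ for constant $U\in U(N-1)$. Moreover $\mathcal I^{-1}=-\mathcal I$ and $\mathcal J=\mathcal I^{-1}\circ\mathcal H\circ\mathcal I$, the operators $\mathcal J$ and $\mathcal I^{-1}$ are compatible symplectic operators, and $\mathcal R=\mathcal H\circ\mathcal I=\mathcal I\circ\mathcal J$ is hereditary. *Flow equation.* Let $\Omega\subset\mathbb R^2$ be open and non-empty, and let $\gamma:\Omega\to SU(N)$, $\gamma(t,x)=g_1g_2^{-1}$ with $g_1,g_2:\Omega\to SU(N)$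 smooth, be a flow of non-stretching curves with coframe and connection $e=\tfrac12(g_1^{-1}dg_1-g_2^{-1}dg_2)$, $\omega=\tfrac12(g_1^{-1}dg_1+g_2^{-1}dg_2)$ that are $SU(N)$-parallel along the curves, that is, for a real constant $\kappa$, $$e_x=\kappa\tfrac{\mathrm i}{N}\begin{pmatrix}1-N&0\\0&\mathbf 1\end{pmatrix},\quad -\tfrac12\operatorname{tr}(e_x^2)=1,\quad \omega_x=\begin{pmatrix}0&\vec v\\-\vec v^{\dagger}&\mathbf 0\end{pmatrix},\quad e_t=\kappa\begin{pmatrix}*&\vec h_\perp\\ *&\mathbf h\end{pmatrix},\quad \omega_t=\begin{pmatrix}*&\vec\varpi\\ *&\boldsymbol\Theta\end{pmatrix}.$$ Let $\chi=\kappa^2$. Then $\chi=2N/(N-1)$ and $$\vec v_t=\mathcal H(\vec\varpi)-\chi\,\mathcal I(\vec h_\perp)=\mathcal R^2(\mathrm i\vec h_\perp)-\chi\,\mathrm i\vec h_\perp,\qquad -\vec\varpi=\mathcal J(\mathrm i\vec h_\perp)=\mathrm i\mathcal H(\vec h_\perp),$$ where $D_x=\partial_x$ and the antiderivatives $D_x^{-1}$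 in $\mathcal H(\vec\varpi)$ are $D_x^{-1}(\bar{\vec v}\wedge^\dagger\vec\varpi)=\boldsymbol\Theta$ and $D_x^{-1}(\bar{\vec v}\cdot^\dagger\mathrm i\vec\varpi)=\tfrac{\mathrm i}{2}\operatorname{tr}\boldsymbol\Theta$, those in $\mathcal H(\vec h_\perp)$ and $\mathcal J(\mathrm i\vec h_\perp)$ are $D_x^{-1}(\bar{\vec v}\wedge^\dagger\vec h_\perp)=\mathbf h$, $D_x^{-1}(\bar{\vec v}\odot^\dagger\mathrm i\vec h_\perp)=\mathrm i\mathbf h$ and $D_x^{-1}(\bar{\vec v}\cdot^\dagger\mathrm i\vec h_\perp)=\tfrac{\mathrm i}{2}\operatorname{tr}\mathbf h$, and those in $\mathcal R^2(\mathrm i\vec h_\perp)=\mathcal R(\mathcal R(\mathrm i\vec h_\perp))$ are the corresponding ones, with $\mathcal R(\mathrm i\vec h_\perp)=-\mathrm i\vec\varpi$. -/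

import Mathlib

open scoped ContDiff Matrix

noncomputable section

namespace CurveFlow

/-! ### Differential algebra

`𝒜` is a commutative `*`-algebra over `ℂ` (not necessarily unital) whose elements play the role of
complex-valued functions on the `x`-jet space of the vector variable `v`; `star` is complex
conjugation and `D` is the total derivative `D_x`.  Typical examples are the differential
polynomials without constant term in `v` and its conjugate, their extensions by nonlocal variables,
and algebras of rapidly decreasing functions of `x` depending on parameters. -/

section Algebra

variable {𝒜 : Type*} [NonUnitalCommRing 𝒜] [StarRing 𝒜] [Module ℂ 𝒜] {n : ℕ}

/-- A derivation of `𝒜` that commutes with complex conjugation. -/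
structure IsStarDerivation (D : 𝒜 →ₗ[ℂ] 𝒜) : Prop where
  leibniz : ∀ f g, D (f * g) = D f * g + f * D g
  map_star : ∀ f, D (star f) = star (D f)

/-- Derivations act on vectors componentwise. -/
def onVec (D : 𝒜 →ₗ[ℂ] 𝒜) (a : Fin n → 𝒜) : Fin n → 𝒜 := fun j => D (a j)

/-- An evolutionary vector field: a (real) derivation that commutes with the total derivative.
Its characteristic, i.e. the vector field on the variable `v`, is `onVec X v`, and `X f` is the
Fréchet derivative of `f` in the direction of that characteristic. -/
structure IsEvolutionary (D X : 𝒜 →ₗ[ℂ] 𝒜) : Prop where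
  derivation : IsStarDerivation X
  comm : ∀ f, X (D f) = D (X f)

/-- `∫ f dx = 0` as a functional, i.e. `f` is a total `x`-derivative. -/
def IsTotalDerivative (D : 𝒜 →ₗ[ℂ] 𝒜) (f : 𝒜) : Prop := ∃ g, D g = f

/-- Hermitian wedge product `A ∧† B = A ⊗ B - B̄ ⊗ Ā`. -/
def wedgeH (a b : Fin n → 𝒜) : Matrix (Fin n) (Fin n) 𝒜 :=
  Matrix.vecMulVec a b - Matrix.vecMulVec (star b) (star a)

/-- Hermitian symmetric product `A ⊙† B = A ⊗ B + B̄ ⊗ Ā`. -/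
def symH (a b : Fin n → 𝒜) : Matrix (Fin n) (Fin n) 𝒜 :=
  Matrix.vecMulVec a b + Matrix.vecMulVec (star b) (star a)

/-- Hermitian dot product `A ·† B = (A · B + B̄ · Ā) / 2`. -/
def dotH (a b : Fin n → 𝒜) : 𝒜 :=
  (1 / 2 : ℂ) • (a ⬝ᵥ b) + (1 / 2 : ℂ) • (star b ⬝ᵥ star a)

/-- The density `Re (ā · b)` of the real pairing between covectors and vectors. -/
def pairing (a b : Fin n → 𝒜) : 𝒜 := dotH (star a) b

/-- The right action of a constant matrix on row vectors. -/
def rotate (U : Matrix (Fin n) (Fin n) ℂ) (a : Fin n → 𝒜) : Fin n → 𝒜 :=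
  fun j => ∑ k, U k j • a k

/-! ### Operators

Nonlocal operators are partially defined, since `D_x⁻¹` is; an operator is represented by its
graph: `T a w` says that `T(a)` is defined and equal to `w`. -/

/-- Operators on vectors, given by their graphs. -/
abbrev Oper (𝒜 : Type*) (n : ℕ) := (Fin n → 𝒜) → (Fin n → 𝒜) → Prop

/-- The graph is that of a single-valued, real-linear, partially defined map. -/
structure IsPartialLinear (T : Oper 𝒜 n) : Prop where
  unique : ∀ a w w', T a w → T a w' → w = w'
  add : ∀ a b w u, T a w → T b u → T (a + b) (w + u)
  smul : ∀ (c : ℝ) a w, T a w → T ((c : ℂ) • a) ((c : ℂ) • w)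

/-- Composition `S ∘ T`. -/
def comp (S T : Oper 𝒜 n) : Oper 𝒜 n := fun a w => ∃ u, T a u ∧ S u w

/-- The inverse operator. -/
def inv (T : Oper 𝒜 n) : Oper 𝒜 n := fun a w => T w a

/-- The linear combination `c₁ S + c₂ T`. -/
def pencil (c₁ c₂ : ℝ) (S T : Oper 𝒜 n) : Oper 𝒜 n :=
  fun a w => ∃ w₁ w₂, S a w₁ ∧ T a w₂ ∧ w = (c₁ : ℂ) • w₁ + (c₂ : ℂ) • w₂

/-- Skew-adjointness modulo total derivatives. -/
def IsSkewAdjoint (D : 𝒜 →ₗ[ℂ] 𝒜) (T : Oper 𝒜 n) : Prop :=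
  ∀ a b wa wb, T a wa → T b wb → IsTotalDerivative D (pairing a wb + pairing b wa)

/-- Cosymplectic (Hamiltonian) operators in the variable `v`: skew-adjoint, with
`⟨a, T'[T b] c⟩ + cyclic = 0` modulo total derivatives for all covectors `a, b, c` in the domain.
Here `T'[T b] c = B (T c) - T (B c)` for the evolutionary vector field `B` with characteristic
`T b`, and `-⟨a, T (B c)⟩` is written `⟨T a, B c⟩`, which is the same thing by skew-adjointness and
does not require `B c` to lie in the domain of `T`. -/
structure IsCosymplectic (D : 𝒜 →ₗ[ℂ] 𝒜) (v : Fin n → 𝒜) (T : Oper 𝒜 n) : Prop where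
  partialLinear : IsPartialLinear T
  skew : IsSkewAdjoint D T
  jacobi : ∀ a b c wa wb wc, T a wa → T b wb → T c wc →
    ∀ A B C, IsEvolutionary D A → IsEvolutionary D B → IsEvolutionary D C →
      onVec A v = wa → onVec B v = wb → onVec C v = wc →
      IsTotalDerivative D
        ((pairing a (onVec B wc) + pairing wa (onVec B c)) +
         (pairing b (onVec C wa) + pairing wb (onVec C a)) +
         (pairing c (onVec A wb) + pairing wc (onVec A b)))

/-- A Hamiltonian pair: all linear combinations are cosymplectic. -/
structure IsHamiltonianPair (D : 𝒜 →ₗ[ℂ] 𝒜) (v : Fin n → 𝒜) (S T : Oper 𝒜 n) : Prop where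
  left : IsCosymplectic D v S
  right : IsCosymplectic D v T
  pencil : ∀ c₁ c₂ : ℝ, IsCosymplectic D v (pencil c₁ c₂ S T)

/-- The characteristic of the commutator of two evolutionary vector fields. -/
def bracket (v : Fin n → 𝒜) (X Y : 𝒜 →ₗ[ℂ] 𝒜) : Fin n → 𝒜 :=
  onVec X (onVec Y v) - onVec Y (onVec X v)

/-- Symplectic operators in the variable `v`: skew-adjoint, with closed 2-form
`ω(Y, Z) = ∫ ⟨Y, T Z⟩ dx`, i.e. `X ω(Y, Z) - ω([X, Y], Z) + cyclic = 0`. -/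
structure IsSymplectic (D : 𝒜 →ₗ[ℂ] 𝒜) (v : Fin n → 𝒜) (T : Oper 𝒜 n) : Prop where
  partialLinear : IsPartialLinear T
  skew : IsSkewAdjoint D T
  closed : ∀ X Y Z, IsEvolutionary D X → IsEvolutionary D Y → IsEvolutionary D Z →
    ∀ wX wY wZ, T (onVec X v) wX → T (onVec Y v) wY → T (onVec Z v) wZ →
      IsTotalDerivative D
        ((X (pairing (onVec Y v) wZ) - pairing (bracket v X Y) wZ) +
         (Y (pairing (onVec Z v) wX) - pairing (bracket v Y Z) wX) +
         (Z (pairing (onVec X v) wY) - pairing (bracket v Z X) wY))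

/-- Hereditary operators: the Nijenhuis torsion vanishes,
`[T X, T Y] = T ([T X, Y] + [X, T Y] - T [X, Y])`, for all evolutionary vector fields `X, Y` in the
domain of `T` (with `TX`, `TY` evolutionary vector fields of characteristics `T X`, `T Y`); it is
part of the claim that the right-hand side is defined. -/
structure IsHereditary (D : 𝒜 →ₗ[ℂ] 𝒜) (v : Fin n → 𝒜) (T : Oper 𝒜 n) : Prop where
  partialLinear : IsPartialLinear T
  torsion : ∀ X Y TX TY, IsEvolutionary D X → IsEvolutionary D Y →
    IsEvolutionary D TX → IsEvolutionary D TY →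
    T (onVec X v) (onVec TX v) → T (onVec Y v) (onVec TY v) →
    ∃ u, T (bracket v X Y) u ∧
      T (bracket v TX Y + bracket v X TY - u) (bracket v TX TY)

/-- Compatible symplectic operators (a symplectic pair): all linear combinations of `S` and `T` are
symplectic and the operator `T⁻¹ ∘ S` relating the two 2-forms is hereditary. -/
structure AreCompatibleSymplectic (D : 𝒜 →ₗ[ℂ] 𝒜) (v : Fin n → 𝒜) (S T : Oper 𝒜 n) : Prop where
  left : IsSymplectic D v S
  right : IsSymplectic D v T
  pencil : ∀ c₁ c₂ : ℝ, IsSymplectic D v (pencil c₁ c₂ S T)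
  hereditary : IsHereditary D v (comp (inv T) S)

/-- `w = D_x a - 2i D_x⁻¹(v̄ ·† i a) v + v ⌟ D_x⁻¹(v̄ ∧† a)`, where the two antiderivatives
`D_x⁻¹` take the values `s` and `Q`. -/
structure IsValueH (D : 𝒜 →ₗ[ℂ] 𝒜) (v a : Fin n → 𝒜) (s : 𝒜) (Q : Matrix (Fin n) (Fin n) 𝒜)
    (w : Fin n → 𝒜) : Prop where
  antideriv_dot : D s = dotH (star v) (Complex.I • a)
  antideriv_wedge : Q.map D = wedgeH (star v) a
  value : w = onVec D a - (fun j => (2 * Complex.I) • (s * v j)) + v ᵥ* Q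

/-- `w = D_x a + 2 D_x⁻¹(v̄ ·† a) v + v ⌟ D_x⁻¹(v̄ ⊙† a)`, where the two antiderivatives
`D_x⁻¹` take the values `s` and `P`. -/
structure IsValueJ (D : 𝒜 →ₗ[ℂ] 𝒜) (v a : Fin n → 𝒜) (s : 𝒜) (P : Matrix (Fin n) (Fin n) 𝒜)
    (w : Fin n → 𝒜) : Prop where
  antideriv_dot : D s = dotH (star v) a
  antideriv_sym : P.map D = symH (star v) a
  value : w = onVec D a + (fun j => (2 : ℂ) • (s * v j)) + v ᵥ* P

/-- The operator `ℋ`. -/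
def opH (D : 𝒜 →ₗ[ℂ] 𝒜) (v : Fin n → 𝒜) : Oper 𝒜 n := fun a w => ∃ s Q, IsValueH D v a s Q w

/-- The operator `𝒥`. -/
def opJ (D : 𝒜 →ₗ[ℂ] 𝒜) (v : Fin n → 𝒜) : Oper 𝒜 n := fun a w => ∃ s P, IsValueJ D v a s P w

/-- The operator `ℐ = i`. -/
def opI : Oper 𝒜 n := fun a w => w = Complex.I • a

/-- The operator `-ℐ`. -/
def opNegI : Oper 𝒜 n := fun a w => w = -(Complex.I • a)

/-- `w = ℛ(a) = ℋ(ℐ(a))`, where the two antiderivatives `D_x⁻¹` take the values `s` and `Q`. -/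
def IsValueR (D : 𝒜 →ₗ[ℂ] 𝒜) (v a : Fin n → 𝒜) (s : 𝒜) (Q : Matrix (Fin n) (Fin n) 𝒜)
    (w : Fin n → 𝒜) : Prop := IsValueH D v (Complex.I • a) s Q w

/-- The operator `ℛ = ℋ ∘ ℐ`. -/
def opR (D : 𝒜 →ₗ[ℂ] 𝒜) (v : Fin n → 𝒜) : Oper 𝒜 n := comp (opH D v) opI

end Algebra

/-! ### Smooth functions of `(t, x)` -/

/-- Extension by zero of a function on an open set of the `(t, x)`-plane. -/
def extendZero (Ω : TopologicalSpace.Opens (ℝ × ℝ)) (f : Ω → ℂ) : ℝ × ℝ → ℂ :=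
  open Classical in fun p => if h : p ∈ Ω then f ⟨p, h⟩ else 0

theorem extendZero_of_mem {Ω : TopologicalSpace.Opens (ℝ × ℝ)} (f : Ω → ℂ) {p : ℝ × ℝ}
    (h : p ∈ Ω) : extendZero Ω f p = f ⟨p, h⟩ := by
  simp [extendZero, h]

/-- The `*`-algebra `C^∞(Ω, ℂ)`. -/
def Smooth (Ω : TopologicalSpace.Opens (ℝ × ℝ)) : StarSubalgebra ℂ (Ω → ℂ) where
  carrier := {f | ContDiffOn ℝ ∞ (extendZero Ω f) Ω}
  mul_mem' := fun {f g} hf hg => (hf.mul hg).congr fun p hp => by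
    simp [extendZero_of_mem _ (show p ∈ Ω from hp)]
  add_mem' := fun {f g} hf hg => (hf.add hg).congr fun p hp => by
    simp [extendZero_of_mem _ (show p ∈ Ω from hp)]
  algebraMap_mem' := fun c => (contDiffOn_const (c := c)).congr fun p hp => by
    simp [extendZero_of_mem _ (show p ∈ Ω from hp)]
  star_mem' := fun {f} hf => (Complex.conjCLE.contDiff.comp_contDiffOn hf).congr fun p hp => by
    simp [extendZero_of_mem _ (show p ∈ Ω from hp)]

theorem smooth_differentiableAt {Ω : TopologicalSpace.Opens (ℝ × ℝ)} (f : Smooth Ω) (p : Ω) :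
    DifferentiableAt ℝ (extendZero Ω f) (p : ℝ × ℝ) :=
  (f.2.contDiffAt (Ω.isOpen.mem_nhds p.2)).differentiableAt (by simp)

/-- The derivative of functions in `C^∞(Ω, ℂ)` in a constant direction. -/
def dir (Ω : TopologicalSpace.Opens (ℝ × ℝ)) (e : ℝ × ℝ) : Smooth Ω →ₗ[ℂ] Smooth Ω where
  toFun f := ⟨fun p => fderiv ℝ (extendZero Ω f) p e,
    ((f.2.fderiv_of_isOpen Ω.isOpen (m := ∞) (by simp)).clm_apply
      (contDiffOn_const (c := e))).congr
      fun p hp => by simp [extendZero_of_mem _ (show p ∈ Ω from hp)]⟩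
  map_add' f g := by
    ext p
    have h : extendZero Ω ((f + g : Smooth Ω) : Ω → ℂ) = extendZero Ω f + extendZero Ω g := by
      ext q; by_cases hq : q ∈ Ω <;> simp [extendZero, hq]
    simp only [h]
    rw [fderiv_add (smooth_differentiableAt f p) (smooth_differentiableAt g p)]
    rfl
  map_smul' c f := by
    ext p
    have h : extendZero Ω ((c • f : Smooth Ω) : Ω → ℂ) = c • extendZero Ω f := by
      ext q; by_cases hq : q ∈ Ω <;> simp [extendZero, hq]
    simp only [h]
    rw [fderiv_const_smul (smooth_differentiableAt f p)]
    rfl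

/-- `∂/∂t` on `C^∞(Ω, ℂ)`. -/
def Dt (Ω : TopologicalSpace.Opens (ℝ × ℝ)) : Smooth Ω →ₗ[ℂ] Smooth Ω := dir Ω (1, 0)

/-- `∂/∂x` on `C^∞(Ω, ℂ)`. -/
def Dx (Ω : TopologicalSpace.Opens (ℝ × ℝ)) : Smooth Ω →ₗ[ℂ] Smooth Ω := dir Ω (0, 1)

/-! ### Curve flows in `SU(N)`, `N = n + 1`

A smooth map `Ω → SU(N)` is an element of the special unitary group over the ring `C^∞(Ω, ℂ)`. -/

section Flow

variable {Ω : TopologicalSpace.Opens (ℝ × ℝ)} {n : ℕ}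

/-- `N × N` matrices of smooth functions, in blocks of sizes `1` and `N - 1`. -/
abbrev SmoothMat (Ω : TopologicalSpace.Opens (ℝ × ℝ)) (n : ℕ) :=
  Matrix (Fin 1 ⊕ Fin n) (Fin 1 ⊕ Fin n) (Smooth Ω)

/-- The component of the pulled-back Maurer–Cartan form `g⁻¹ dg` along the derivative `D`. -/
def maurerCartan (D : Smooth Ω →ₗ[ℂ] Smooth Ω) (g : SmoothMat Ω n) : SmoothMat Ω n :=
  gᴴ * g.map D

/-- The component along `D` of the coframe: the part of the Maurer–Cartan form of
`SU(N) × SU(N)` that is antisymmetric under the permutation of the two factors. -/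
def coframe (D : Smooth Ω →ₗ[ℂ] Smooth Ω) (g₁ g₂ : SmoothMat Ω n) : SmoothMat Ω n :=
  (1 / 2 : ℂ) • (maurerCartan D g₁ - maurerCartan D g₂)

/-- The component along `D` of the connection: the symmetric part. -/
def connection (D : Smooth Ω →ₗ[ℂ] Smooth Ω) (g₁ g₂ : SmoothMat Ω n) : SmoothMat Ω n :=
  (1 / 2 : ℂ) • (maurerCartan D g₁ + maurerCartan D g₂)

/-- A flow `γ(t, x)` of non-stretching curves in `SU(N) ≃ (SU(N) × SU(N)) / diag`, with a lift
`(g₁, g₂)` to `SU(N) × SU(N)` whose coframe `e` and connection `ω` are `SU(N)`-parallel along the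
curves; `v`, `h`, `hb`, `ϖ`, `Θ` are the components of `ω_x`, `e_t` and `ω_t`. -/
structure IsParallelCurveFlow (κ : ℝ) (γ g₁ g₂ : SmoothMat Ω n)
    (v h ϖ : Fin n → Smooth Ω) (hb Θ : Matrix (Fin n) (Fin n) (Smooth Ω)) : Prop where
  mem₁ : g₁ ∈ Matrix.specialUnitaryGroup (Fin 1 ⊕ Fin n) (Smooth Ω)
  mem₂ : g₂ ∈ Matrix.specialUnitaryGroup (Fin 1 ⊕ Fin n) (Smooth Ω)
  lift : γ = g₁ * g₂ᴴ
  /-- `e_x = κ (i/N) diag(1 - N, 1, …, 1)`. -/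
  tangent : coframe (Dx Ω) g₁ g₂ =
    ((κ : ℂ) * Complex.I / ((n : ℂ) + 1)) • Matrix.fromBlocks (-((n : ℂ) • 1)) 0 0 1
  /-- `x` is arclength: `⟨e_x, e_x⟩ = -tr(e_x²)/2 = 1`. -/
  arclength : (-(1 / 2) : ℂ) •
    Matrix.trace (coframe (Dx Ω) g₁ g₂ * coframe (Dx Ω) g₁ g₂) = 1
  /-- `ω_x` is orthogonal to the centralizer `𝔲(N-1)` of `e_x`. -/
  parallel : connection (Dx Ω) g₁ g₂ =
    Matrix.fromBlocks 0 (Matrix.replicateRow (Fin 1) v) (-(Matrix.replicateRow (Fin 1) v)ᴴ) 0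
  normal : (coframe (Dt Ω) g₁ g₂).toBlocks₁₂ = (κ : ℂ) • Matrix.replicateRow (Fin 1) h
  /-- `hb = 𝐡_⊥ + N⁻¹ h_∥ i 𝟏`. -/
  central : (coframe (Dt Ω) g₁ g₂).toBlocks₂₂ = (κ : ℂ) • hb
  conn_normal : (connection (Dt Ω) g₁ g₂).toBlocks₁₂ = Matrix.replicateRow (Fin 1) ϖ
  conn_central : (connection (Dt Ω) g₁ g₂).toBlocks₂₂ = Θ

end Flow

end CurveFlow

end

/-! A row vector `a` is placed in the off-diagonal blocks of the skew-Hermitian matrix `offDiag a`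
of size 1 + n, which turns the pairing into -1/2 times the trace form (`pairing_eq_trace`). The two
antiderivatives in ℋ(a) then merge into one block diagonal matrix K: ℋ(a) = w exactly when the
covariant derivative ∇ = D + [v, ·] sends W = a + K to the purely off-diagonal matrix w
(`opH_iff_isLift`, `IsLift.covariant`). The diagonal part of ∇W = w is the equation that defines the
antiderivatives, the off-diagonal part is the value of ℋ.

Multiplication by i extends to the derivation `quarterTurn`, which kills block diagonal matrices.
Hence c₁ℋ + c₂ℐ is governed by the derivation ∇' = c₁∇ + c₂ `quarterTurn` (`covDeriv`). Three facts
about it suffice: it obeys the Leibniz rule, the trace of anything in its image is a total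
derivative, and a vector field X commutes with it up to c₁[Xv, ·] (`covDeriv_mul`, `trace_covDeriv`,
`mapMatrix_covDeriv`). Skew-adjointness is the trace of ∇'(W_a W_b). The Jacobi sum reduces to the
trace of ∇'(W_a [W_b, W_c]), so every member of the pencil is cosymplectic at once.

For 𝒥 = ℐ⁻¹ℋℐ the same integration by parts leaves a cyclic trace that vanishes identically, by the
Leibniz rule for `quarterTurn` (`cyclic_trace_eq_zero`). For ℛ = ℋℐ let W_X be the lift belonging to
ℛ(X). The zero-curvature combination TX(W_Y) - TY(W_X) + [W_X, W_Y] is sent by ∇ to the commutator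
[TX, TY], and its off-diagonal part is i times the argument of ℛ in the torsion identity
(`isHereditary_opR`).

The flow equation consists of the two Cartan structure equations of a pair of Maurer–Cartan forms.
Since ad(e_x) is -κ `quarterTurn`, they say ∇e_t = κ² iϖ/κ, that is ℋ(h) = iϖ, and ∇ω_t = v_t + κ² i
h (`isLift_of_parallel`). The arclength condition fixes κ². -/

noncomputable section

namespace CurveFlow

open Matrix

/-! ### Commutators in a non-unital ring -/

section Commutator

variable {M : Type*} [NonUnitalRing M]

/-- The commutator `X Y - Y X`. -/
def commutator (X Y : M) : M := X * Y - Y * X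

theorem commutator_add (X Y Z : M) :
    commutator X (Y + Z) = commutator X Y + commutator X Z := by
  simp only [commutator, mul_add, add_mul]; abel

theorem add_commutator (X Y Z : M) :
    commutator (X + Y) Z = commutator X Z + commutator Y Z := by
  simp only [commutator, mul_add, add_mul]; abel

theorem commutator_sub (X Y Z : M) :
    commutator X (Y - Z) = commutator X Y - commutator X Z := by
  simp only [commutator, mul_sub, sub_mul]; abel

theorem sub_commutator (X Y Z : M) :
    commutator (X - Y) Z = commutator X Z - commutator Y Z := by
  simp only [commutator, mul_sub, sub_mul]; abel

theorem commutator_swap (X Y : M) : commutator X Y = -commutator Y X := by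
  simp [commutator]

theorem map_commutator {F : Type*} [FunLike F M M] [AddMonoidHomClass F M M] (δ : F)
    (h : ∀ X Y, δ (X * Y) = δ X * Y + X * δ Y) (X Y : M) :
    δ (commutator X Y) = commutator (δ X) Y + commutator X (δ Y) := by
  simp only [commutator, map_sub, h]; abel

end Commutator

/-! ### Block matrices graded by block diagonal and off-diagonal parts, and the trace form. -/

section Algebra

variable {𝒜 : Type*} [NonUnitalCommRing 𝒜] {n : ℕ}

/-- Square matrices in blocks of sizes `1` and `n`. -/
abbrev BlockMat (𝒜 : Type*) (n : ℕ) := Matrix (Fin 1 ⊕ Fin n) (Fin 1 ⊕ Fin n) 𝒜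

/-- Both off-diagonal blocks vanish. -/
structure IsBlockDiag (K : BlockMat 𝒜 n) : Prop where
  upper : K.toBlocks₁₂ = 0
  lower : K.toBlocks₂₁ = 0

/-- Both diagonal blocks vanish. -/
structure IsBlockOff (K : BlockMat 𝒜 n) : Prop where
  upper : K.toBlocks₁₁ = 0
  lower : K.toBlocks₂₂ = 0

theorem IsBlockDiag.eq {K : BlockMat 𝒜 n} (h : IsBlockDiag K) :
    K = fromBlocks K.toBlocks₁₁ 0 0 K.toBlocks₂₂ := by
  conv_lhs => rw [← fromBlocks_toBlocks K, h.upper, h.lower]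

theorem IsBlockOff.eq {K : BlockMat 𝒜 n} (h : IsBlockOff K) :
    K = fromBlocks 0 K.toBlocks₁₂ K.toBlocks₂₁ 0 := by
  conv_lhs => rw [← fromBlocks_toBlocks K, h.upper, h.lower]

theorem isBlockDiag_fromBlocks (A : Matrix (Fin 1) (Fin 1) 𝒜) (B : Matrix (Fin n) (Fin n) 𝒜) :
    IsBlockDiag (fromBlocks A 0 0 B) := ⟨by simp, by simp⟩

theorem isBlockOff_fromBlocks (A : Matrix (Fin 1) (Fin n) 𝒜) (B : Matrix (Fin n) (Fin 1) 𝒜) :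
    IsBlockOff (fromBlocks 0 A B 0) := ⟨by simp, by simp⟩

theorem IsBlockDiag.add {K L : BlockMat 𝒜 n} (hK : IsBlockDiag K) (hL : IsBlockDiag L) :
    IsBlockDiag (K + L) := by
  rw [hK.eq, hL.eq, fromBlocks_add]; simpa using isBlockDiag_fromBlocks _ _

theorem IsBlockDiag.neg {K : BlockMat 𝒜 n} (hK : IsBlockDiag K) : IsBlockDiag (-K) := by
  rw [hK.eq, fromBlocks_neg]; simpa using isBlockDiag_fromBlocks _ _

theorem IsBlockDiag.sub {K L : BlockMat 𝒜 n} (hK : IsBlockDiag K) (hL : IsBlockDiag L) :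
    IsBlockDiag (K - L) := by
  rw [sub_eq_add_neg]; exact hK.add hL.neg

theorem IsBlockOff.add {K L : BlockMat 𝒜 n} (hK : IsBlockOff K) (hL : IsBlockOff L) :
    IsBlockOff (K + L) := by
  rw [hK.eq, hL.eq, fromBlocks_add]; simpa using isBlockOff_fromBlocks _ _

theorem IsBlockOff.neg {K : BlockMat 𝒜 n} (hK : IsBlockOff K) : IsBlockOff (-K) := by
  rw [hK.eq, fromBlocks_neg]; simpa using isBlockOff_fromBlocks _ _

theorem IsBlockOff.sub {K L : BlockMat 𝒜 n} (hK : IsBlockOff K) (hL : IsBlockOff L) :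
    IsBlockOff (K - L) := by
  rw [sub_eq_add_neg]; exact hK.add hL.neg

theorem IsBlockDiag.commutator {K L : BlockMat 𝒜 n} (hK : IsBlockDiag K) (hL : IsBlockDiag L) :
    IsBlockDiag (commutator K L) := by
  rw [hK.eq, hL.eq, CurveFlow.commutator, fromBlocks_multiply, fromBlocks_multiply]
  simpa using (isBlockDiag_fromBlocks _ _).sub (isBlockDiag_fromBlocks _ _)

theorem IsBlockOff.commutator {K L : BlockMat 𝒜 n} (hK : IsBlockOff K) (hL : IsBlockOff L) :
    IsBlockDiag (commutator K L) := by
  rw [hK.eq, hL.eq, CurveFlow.commutator, fromBlocks_multiply, fromBlocks_multiply]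
  simpa using (isBlockDiag_fromBlocks _ _).sub (isBlockDiag_fromBlocks _ _)

theorem IsBlockOff.commutator_diag {K L : BlockMat 𝒜 n} (hK : IsBlockOff K)
    (hL : IsBlockDiag L) : IsBlockOff (CurveFlow.commutator K L) := by
  rw [hK.eq, hL.eq, CurveFlow.commutator, fromBlocks_multiply, fromBlocks_multiply]
  simpa using (isBlockOff_fromBlocks _ _).sub (isBlockOff_fromBlocks _ _)

/-- A block diagonal and a block off-diagonal matrix are determined by their sum. -/
theorem eq_of_diag_add_off_eq {K K' L L' : BlockMat 𝒜 n} (hK : IsBlockDiag K)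
    (hK' : IsBlockDiag K') (hL : IsBlockOff L) (hL' : IsBlockOff L') (h : K + L = K' + L') :
    K = K' ∧ L = L' := by
  rw [hK.eq, hL.eq, hK'.eq, hL'.eq, fromBlocks_add, fromBlocks_add, fromBlocks_inj] at h
  simp only [add_zero, zero_add] at h
  obtain ⟨h₁, h₂, h₃, h₄⟩ := h
  rw [hK.eq, hL.eq, hK'.eq, hL'.eq, h₁, h₂, h₃, h₄]
  exact ⟨rfl, rfl⟩

theorem trace_fromBlocks {R ι κ : Type*} [AddCommMonoid R] [Fintype ι] [Fintype κ]
    (A : Matrix ι ι R) (B : Matrix ι κ R) (C : Matrix κ ι R) (E : Matrix κ κ R) :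
    trace (fromBlocks A B C E) = trace A + trace E := by
  simp [trace]

theorem trace_off_mul_diag {K L : BlockMat 𝒜 n} (hK : IsBlockOff K) (hL : IsBlockDiag L) :
    trace (K * L) = 0 := by
  rw [hK.eq, hL.eq, fromBlocks_multiply]; simp [trace_fromBlocks]

theorem trace_diag_mul_off {K L : BlockMat 𝒜 n} (hK : IsBlockDiag K) (hL : IsBlockOff L) :
    trace (K * L) = 0 := by
  rw [trace_mul_comm, trace_off_mul_diag hL hK]

/-- Ad-invariance of the trace form. -/
theorem trace_commutator_mul (X Y Z : BlockMat 𝒜 n) :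
    trace (commutator X Y * Z) = trace (X * commutator Y Z) := by
  simp only [commutator, sub_mul, mul_sub, trace_sub, mul_assoc]
  rw [trace_mul_comm Y (X * Z), mul_assoc]

theorem trace_commutator (X Y : BlockMat 𝒜 n) : trace (commutator X Y) = 0 := by
  rw [commutator, trace_sub, trace_mul_comm, sub_self]

/-- The traceless block diagonal matrix with lower right block `Q`. -/
def tracelessDiag (Q : Matrix (Fin n) (Fin n) 𝒜) : BlockMat 𝒜 n :=
  fromBlocks (of fun _ _ => -Q.trace) 0 0 Q

theorem isBlockDiag_tracelessDiag (Q : Matrix (Fin n) (Fin n) 𝒜) :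
    IsBlockDiag (tracelessDiag Q) := isBlockDiag_fromBlocks _ _

section Module

variable [Module ℂ 𝒜]

theorem IsBlockDiag.mapMatrix {K : BlockMat 𝒜 n} (hK : IsBlockDiag K) (D : 𝒜 →ₗ[ℂ] 𝒜) :
    IsBlockDiag (D.mapMatrix K) := by
  rw [hK.eq]
  constructor <;> ext <;> simp [toBlocks₁₂, toBlocks₂₁]

theorem trace_mapMatrix (D : 𝒜 →ₗ[ℂ] 𝒜) (W : BlockMat 𝒜 n) :
    trace (D.mapMatrix W) = D (trace W) := by
  simp [trace, map_sum]

/-- The derivation `fromBlocks A B C E ↦ fromBlocks 0 (i B) (-i C) 0` of block matrices. -/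
def quarterTurn : BlockMat 𝒜 n →ₗ[ℂ] BlockMat 𝒜 n where
  toFun W := fromBlocks 0 (Complex.I • W.toBlocks₁₂) (-(Complex.I • W.toBlocks₂₁)) 0
  map_add' X Y := by
    ext i j; rcases i with i | i <;> rcases j with j | j <;>
      simp [toBlocks₁₂, toBlocks₂₁, add_comm]
  map_smul' c X := by
    ext i j; rcases i with i | i <;> rcases j with j | j <;>
      simp [toBlocks₁₂, toBlocks₂₁, smul_comm c Complex.I]

theorem quarterTurn_apply (W : BlockMat 𝒜 n) : quarterTurn W =
    fromBlocks 0 (Complex.I • W.toBlocks₁₂) (-(Complex.I • W.toBlocks₂₁)) 0 := rfl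

theorem quarterTurn_of_diag {K : BlockMat 𝒜 n} (hK : IsBlockDiag K) : quarterTurn K = 0 := by
  simp [quarterTurn_apply, hK.upper, hK.lower]

theorem trace_quarterTurn (W : BlockMat 𝒜 n) : trace (quarterTurn W) = 0 := by
  simp [quarterTurn_apply, trace_fromBlocks]

/-- Formally `quarterTurn` is the commutator with diag(i, 0). That matrix need not exist over a
non-unital 𝒜, so the Leibniz rule is checked on blocks. -/
theorem quarterTurn_mul [IsScalarTower ℂ 𝒜 𝒜] [SMulCommClass ℂ 𝒜 𝒜] (X Y : BlockMat 𝒜 n) :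
    quarterTurn (X * Y) = quarterTurn X * Y + X * quarterTurn Y := by
  rw [← fromBlocks_toBlocks X, ← fromBlocks_toBlocks Y]
  simp only [quarterTurn_apply, fromBlocks_multiply, toBlocks_fromBlocks₁₂,
    toBlocks_fromBlocks₂₁, fromBlocks_add]
  congr 1 <;> simp [smul_add, Matrix.smul_mul, Matrix.mul_smul, add_comm]

theorem mapMatrix_quarterTurn (D : 𝒜 →ₗ[ℂ] 𝒜) (W : BlockMat 𝒜 n) :
    D.mapMatrix (quarterTurn W) = quarterTurn (D.mapMatrix W) := by
  ext i j; rcases i with i | i <;> rcases j with j | j <;>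
    simp [quarterTurn_apply, toBlocks₁₂, toBlocks₂₁]

end Module

variable [StarRing 𝒜]

/-- The skew-Hermitian block matrix with vanishing diagonal blocks and upper right block `a`. -/
def offDiag (a : Fin n → 𝒜) : BlockMat 𝒜 n :=
  fromBlocks 0 (replicateRow (Fin 1) a) (-(replicateRow (Fin 1) a)ᴴ) 0

theorem isBlockOff_offDiag (a : Fin n → 𝒜) : IsBlockOff (offDiag a) := isBlockOff_fromBlocks _ _

theorem offDiag_injective : Function.Injective (offDiag (𝒜 := 𝒜) (n := n)) := by
  intro a b h
  have := (fromBlocks_inj.1 h).2.1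
  ext j
  exact congrFun (congrFun this 0) j

/-- The two right-hand blocks determine M: skew-Hermitian symmetry gives the lower left block and
tracelessness gives the corner entry. -/
theorem eq_offDiag_add_tracelessDiag {M : BlockMat 𝒜 n} (hM : Mᴴ = -M) (htr : trace M = 0)
    {a : Fin n → 𝒜} {Q : Matrix (Fin n) (Fin n) 𝒜}
    (h₁₂ : M.toBlocks₁₂ = replicateRow (Fin 1) a) (h₂₂ : M.toBlocks₂₂ = Q) :
    M = offDiag a + tracelessDiag Q := by
  have h₂₁ : M.toBlocks₂₁ = -(replicateRow (Fin 1) a)ᴴ := by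
    rw [← h₁₂]
    ext i j
    have := congrFun (congrFun hM (Sum.inr i)) (Sum.inl j)
    simp only [conjTranspose_apply, Matrix.neg_apply] at this
    simp [toBlocks₂₁, toBlocks₁₂, this]
  have h₁₁ : M.toBlocks₁₁ = of fun _ _ => -Q.trace := by
    rw [← fromBlocks_toBlocks M, trace_fromBlocks, h₂₂] at htr
    ext i j
    rw [Subsingleton.elim i 0, Subsingleton.elim j 0, of_apply, ← eq_neg_of_add_eq_zero_left htr]
    simp [trace]
  rw [← fromBlocks_toBlocks M, h₁₁, h₁₂, h₂₁, h₂₂, offDiag, tracelessDiag, fromBlocks_add]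
  simp

theorem offDiag_add (a b : Fin n → 𝒜) : offDiag (a + b) = offDiag a + offDiag b := by
  ext i j; rcases i with i | i <;> rcases j with j | j <;> simp [offDiag, add_comm]

theorem offDiag_neg (a : Fin n → 𝒜) : offDiag (-a) = -offDiag a := by
  ext i j; rcases i with i | i <;> rcases j with j | j <;> simp [offDiag]

theorem offDiag_sub (a b : Fin n → 𝒜) : offDiag (a - b) = offDiag a - offDiag b := by
  rw [sub_eq_add_neg, sub_eq_add_neg, offDiag_add, offDiag_neg]

variable [Module ℂ 𝒜]

theorem offDiag_smul [StarModule ℂ 𝒜] (c : ℝ) (a : Fin n → 𝒜) :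
    offDiag ((c : ℂ) • a) = (c : ℂ) • offDiag a := by
  ext i j; rcases i with i | i <;> rcases j with j | j <;> simp [offDiag]

theorem mapMatrix_offDiag {D : 𝒜 →ₗ[ℂ] 𝒜} (hD : IsStarDerivation D) (a : Fin n → 𝒜) :
    D.mapMatrix (offDiag a) = offDiag (onVec D a) := by
  ext i j
  rcases i with i | i <;> rcases j with j | j <;> simp [offDiag, onVec, hD.map_star]

theorem mapMatrix_mul {D : 𝒜 →ₗ[ℂ] 𝒜} (hD : IsStarDerivation D) (X Y : BlockMat 𝒜 n) :
    D.mapMatrix (X * Y) = D.mapMatrix X * Y + X * D.mapMatrix Y := by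
  ext i j
  simp only [LinearMap.mapMatrix_apply, Matrix.map_apply, Matrix.add_apply, mul_apply, map_sum,
    hD.leibniz, Finset.sum_add_distrib]

theorem mapMatrix_comm {D X : 𝒜 →ₗ[ℂ] 𝒜} (h : IsEvolutionary D X) (W : BlockMat 𝒜 n) :
    X.mapMatrix (D.mapMatrix W) = D.mapMatrix (X.mapMatrix W) := by
  ext i j; simp [h.comm]

theorem quarterTurn_offDiag [StarModule ℂ 𝒜] (a : Fin n → 𝒜) :
    quarterTurn (offDiag a) = offDiag (Complex.I • a) := by
  ext i j; rcases i with i | i <;> rcases j with j | j <;>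
    simp [quarterTurn_apply, offDiag, toBlocks₁₂, toBlocks₂₁]

theorem pairing_eq_trace (a b : Fin n → 𝒜) :
    pairing a b = (-(1 / 2) : ℂ) • trace (offDiag a * offDiag b) := by
  have h : trace (offDiag a * offDiag b) = -(star a ⬝ᵥ b + star b ⬝ᵥ a) := by
    rw [offDiag, offDiag, fromBlocks_multiply, trace_fromBlocks]
    simp only [trace, Matrix.diag, mul_apply, dotProduct, Matrix.add_apply]
    simp [Finset.sum_neg_distrib, mul_comm, add_comm]
  rw [h, pairing, dotH, star_star, smul_neg, neg_smul, neg_neg, smul_add]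

theorem pairing_comm (a b : Fin n → 𝒜) : pairing a b = pairing b a := by
  rw [pairing_eq_trace, pairing_eq_trace, trace_mul_comm]

theorem pairing_eq_trace_left {K : BlockMat 𝒜 n} (hK : IsBlockDiag K) (a b : Fin n → 𝒜) :
    pairing a b = (-(1 / 2) : ℂ) • trace ((offDiag a + K) * offDiag b) := by
  rw [add_mul, trace_add, trace_diag_mul_off hK (isBlockOff_offDiag b), add_zero, pairing_eq_trace]

theorem pairing_eq_trace_right {K : BlockMat 𝒜 n} (hK : IsBlockDiag K) (a b : Fin n → 𝒜) :
    pairing a b = (-(1 / 2) : ℂ) • trace (offDiag a * (offDiag b + K)) := by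
  rw [pairing_comm, pairing_eq_trace_left hK, trace_mul_comm]

end Algebra

/-! ### Uniqueness of antiderivatives when D has trivial kernel. -/

section Kernel

variable {𝒜 : Type*} [NonUnitalCommRing 𝒜] [Module ℂ 𝒜] {n : ℕ}

theorem eq_of_map_eq {D : 𝒜 →ₗ[ℂ] 𝒜} (h0 : ∀ f, D f = 0 → f = 0) {f g : 𝒜} (h : D f = D g) :
    f = g := by
  rw [← sub_eq_zero]; exact h0 _ (by rw [map_sub, h, sub_self])

theorem mapMatrix_injective {D : 𝒜 →ₗ[ℂ] 𝒜} (h0 : ∀ f, D f = 0 → f = 0) :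
    Function.Injective (D.mapMatrix : BlockMat 𝒜 n →ₗ[ℂ] BlockMat 𝒜 n) := by
  intro K L h
  ext i j
  exact eq_of_map_eq h0 (congrFun (congrFun h i) j)

end Kernel

/-! ### ℋ as a covariant derivative of lifts to block matrices. -/

section Lift

variable {𝒜 : Type*} [NonUnitalCommRing 𝒜] [StarRing 𝒜] {n : ℕ}

theorem commutator_offDiag (v a : Fin n → 𝒜) :
    commutator (offDiag v) (offDiag a) =
      fromBlocks (of fun _ _ => a ⬝ᵥ star v - v ⬝ᵥ star a) 0 0 (-wedgeH (star v) a) := by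
  rw [commutator, offDiag, offDiag, fromBlocks_multiply, fromBlocks_multiply]
  ext i j; rcases i with i | i <;> rcases j with j | j <;>
    simp [mul_apply, dotProduct, wedgeH, vecMulVec_apply, neg_add_eq_sub]

theorem trace_wedgeH (a b : Fin n → 𝒜) :
    trace (wedgeH a b) = a ⬝ᵥ b - star b ⬝ᵥ star a := by
  simp [wedgeH, trace_sub, trace_vecMulVec]

theorem conjTranspose_wedgeH (a b : Fin n → 𝒜) : (wedgeH a b)ᴴ = -wedgeH a b := by
  simp [wedgeH, conjTranspose_sub, conjTranspose_vecMulVec]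

variable [Module ℂ 𝒜]

/-- This makes the scalar antiderivative in ℋ a multiple of the trace of the matrix one, so that a
single traceless block diagonal matrix carries both. -/
theorem dotH_I_smul [IsScalarTower ℂ 𝒜 𝒜] [SMulCommClass ℂ 𝒜 𝒜] [StarModule ℂ 𝒜]
    (a b : Fin n → 𝒜) :
    dotH a (Complex.I • b) = (Complex.I / 2) • trace (wedgeH a b) := by
  rw [trace_wedgeH, dotH, dotProduct_smul, star_smul, smul_dotProduct, smul_smul, smul_smul,
    smul_sub, sub_eq_add_neg, ← neg_smul]
  congr 2 <;> simp <;> ring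

theorem mapMatrix_conjTranspose {D : 𝒜 →ₗ[ℂ] 𝒜} (hD : IsStarDerivation D)
    (Q : Matrix (Fin n) (Fin n) 𝒜) : Qᴴ.map D = (Q.map D)ᴴ := by
  ext i j; simp [hD.map_star]

/-- `w = ℋ(a)`, with the antiderivatives in `ℋ(a)` collected in the block diagonal matrix `K`:
the covariant derivative `D + [v, ·]` of the matrix with off-diagonal part `a` and diagonal part
`K` is purely off-diagonal, and is `w`. -/
structure IsLift (D : 𝒜 →ₗ[ℂ] 𝒜) (v a w : Fin n → 𝒜) (K : BlockMat 𝒜 n) : Prop where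
  blockDiag : IsBlockDiag K
  antideriv : D.mapMatrix K + commutator (offDiag v) (offDiag a) = 0
  value : offDiag (onVec D a) + commutator (offDiag v) K = offDiag w

theorem IsLift.covariant {D : 𝒜 →ₗ[ℂ] 𝒜} (hD : IsStarDerivation D) {v a w : Fin n → 𝒜}
    {K : BlockMat 𝒜 n} (h : IsLift D v a w K) :
    D.mapMatrix (offDiag a + K) + commutator (offDiag v) (offDiag a + K) = offDiag w := by
  rw [map_add, mapMatrix_offDiag hD, commutator_add, ← h.value,
    eq_neg_of_add_eq_zero_left h.antideriv]
  abel

/-- Bracketing with an off-diagonal matrix exchanges the two grades, so the graded components of the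
one covariant equation are exactly the two equations of a lift. -/
theorem isLift_of_covariant {D : 𝒜 →ₗ[ℂ] 𝒜} (hD : IsStarDerivation D) {v a w : Fin n → 𝒜}
    {K : BlockMat 𝒜 n} (hK : IsBlockDiag K)
    (h : D.mapMatrix (offDiag a + K) + commutator (offDiag v) (offDiag a + K) = offDiag w) :
    IsLift D v a w K := by
  have h' : (D.mapMatrix K + commutator (offDiag v) (offDiag a)) +
      (offDiag (onVec D a) + commutator (offDiag v) K) = 0 + offDiag w := by
    rw [zero_add, ← h, map_add, mapMatrix_offDiag hD, commutator_add]; abel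
  obtain ⟨h₁, h₂⟩ := eq_of_diag_add_off_eq
    ((hK.mapMatrix D).add ((isBlockOff_offDiag v).commutator (isBlockOff_offDiag a)))
    ⟨rfl, rfl⟩
    ((isBlockOff_offDiag _).add ((isBlockOff_offDiag v).commutator_diag hK))
    (isBlockOff_offDiag w) h'
  exact ⟨hK, h₁, h₂⟩

/-- The value of `ℋ` in terms of the antiderivative of `v̄ ∧† a`. -/
theorem isLift_of_antideriv {D : 𝒜 →ₗ[ℂ] 𝒜} (hD : IsStarDerivation D)
    (h0 : ∀ f, D f = 0 → f = 0) {v a : Fin n → 𝒜} {Q : Matrix (Fin n) (Fin n) 𝒜}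
    (hQ : Q.map D = wedgeH (star v) a) :
    IsLift D v a (fun j => D (a j) + Q.trace * v j + (v ᵥ* Q) j)
      (tracelessDiag Q) := by
  -- The wedge product is skew-Hermitian, so D kills Q + Qᴴ, and the trivial kernel makes Q itself
  -- skew-Hermitian. The lower left block needs this.
  have hQ' : Qᴴ = -Q := by
    ext i j
    refine eq_of_map_eq h0 ?_
    have := congrFun (congrFun (mapMatrix_conjTranspose hD Q) i) j
    rw [hQ, conjTranspose_wedgeH, ← hQ] at this
    simpa using this
  have hst : star Q.trace = -Q.trace := by rw [← trace_conjTranspose, hQ', trace_neg]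
  have htr : D Q.trace = trace (wedgeH (star v) a) := by
    rw [← hQ]; simp [trace, map_sum]
  refine ⟨isBlockDiag_fromBlocks _ _, ?_, ?_⟩
  · rw [commutator_offDiag, tracelessDiag]
    ext i j; rcases i with i | i <;> rcases j with j | j
    · simp [htr, trace_wedgeH, dotProduct_comm]
    · simp
    · simp
    · simp [← hQ]
  · rw [commutator, offDiag, offDiag, offDiag, tracelessDiag, fromBlocks_multiply,
      fromBlocks_multiply]
    ext i j; rcases i with i | i <;> rcases j with j | j
    · simp
    · simp [mul_apply, vecMul, dotProduct, onVec]
      abel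
    · have : ∑ k, Q i k * star (v k) = -star (∑ k, v k * Q k i) := by
        rw [star_sum, ← Finset.sum_neg_distrib]
        refine Finset.sum_congr rfl fun k _ => ?_
        have := congrFun (congrFun hQ' i) k
        rw [conjTranspose_apply, Matrix.neg_apply] at this
        rw [star_mul, this, neg_mul, neg_neg]
      simp [mul_apply, vecMul, dotProduct, onVec, hst, this, mul_comm]
      abel
    · simp

theorem toBlocks₂₂_map_eq_wedgeH {D : 𝒜 →ₗ[ℂ] 𝒜} {v a : Fin n → 𝒜} {K : BlockMat 𝒜 n}
    (h : D.mapMatrix K + commutator (offDiag v) (offDiag a) = 0) :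
    K.toBlocks₂₂.map D = wedgeH (star v) a := by
  have := congrArg toBlocks₂₂ h
  rw [commutator_offDiag] at this
  ext i j
  have := congrFun (congrFun this i) j
  simpa [toBlocks₂₂, ← sub_eq_add_neg, sub_eq_zero] using this

/-- K and the traceless matrix built from its lower right block have the same derivative, hence
coincide. This supplies the reality and trace conditions that make [v, K] of the form `offDiag`. -/
theorem exists_isLift {D : 𝒜 →ₗ[ℂ] 𝒜} (hD : IsStarDerivation D)
    (h0 : ∀ f, D f = 0 → f = 0) {v a : Fin n → 𝒜} {K : BlockMat 𝒜 n}
    (h : D.mapMatrix K + commutator (offDiag v) (offDiag a) = 0) :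
    ∃ w, IsLift D v a w K := by
  have hL := isLift_of_antideriv hD h0 (toBlocks₂₂_map_eq_wedgeH h)
  rw [← mapMatrix_injective h0 (add_right_cancel (h.trans hL.antideriv.symm))] at hL
  exact ⟨_, hL⟩

theorem IsLift.unique {D : 𝒜 →ₗ[ℂ] 𝒜} (h0 : ∀ f, D f = 0 → f = 0) {v a w w' : Fin n → 𝒜}
    {K K' : BlockMat 𝒜 n} (h : IsLift D v a w K) (h' : IsLift D v a w' K') : w = w' := by
  obtain rfl : K = K' :=
    mapMatrix_injective h0 (add_right_cancel (h.antideriv.trans h'.antideriv.symm))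
  exact offDiag_injective (h.value.symm.trans h'.value)

variable [IsScalarTower ℂ 𝒜 𝒜] [SMulCommClass ℂ 𝒜 𝒜] [StarModule ℂ 𝒜]

theorem isValueH_of_wedge {D : 𝒜 →ₗ[ℂ] 𝒜} {v a w : Fin n → 𝒜} {Q : Matrix (Fin n) (Fin n) 𝒜}
    (hQ : Q.map D = wedgeH (star v) a)
    (hw : w = fun j => D (a j) + Q.trace * v j + (v ᵥ* Q) j) :
    IsValueH D v a ((Complex.I / 2) • Q.trace) Q w where
  antideriv_dot := by
    rw [map_smul, dotH_I_smul, ← hQ]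
    simp [trace, map_sum]
  antideriv_wedge := hQ
  value := by
    rw [hw]
    ext j
    -- With s = (i/2) tr Q, the term -2i s v of ℋ becomes + (tr Q) v.
    have : (2 * Complex.I) * (Complex.I / 2) = -1 := by
      rw [mul_assoc, mul_div_assoc', Complex.I_mul_I, mul_div_cancel₀ _ two_ne_zero]
    simp [onVec, smul_mul_assoc, smul_smul, this]

/-- The scalar antiderivative is redundant: (i/2) tr Q is one, and the trivial kernel allows no
other. -/
theorem opH_iff_wedge {D : 𝒜 →ₗ[ℂ] 𝒜} (h0 : ∀ f, D f = 0 → f = 0) {v a w : Fin n → 𝒜} :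
    opH D v a w ↔ ∃ Q : Matrix (Fin n) (Fin n) 𝒜, Q.map D = wedgeH (star v) a ∧
      w = fun j => D (a j) + Q.trace * v j + (v ᵥ* Q) j := by
  constructor
  · rintro ⟨s, Q, h₁, h₂, rfl⟩
    have h := isValueH_of_wedge h₂ rfl
    obtain rfl : s = (Complex.I / 2) • Q.trace := eq_of_map_eq h0 (h₁.trans h.antideriv_dot.symm)
    exact ⟨Q, h₂, h.value.symm⟩
  · rintro ⟨Q, h₂, h₃⟩
    exact ⟨_, Q, isValueH_of_wedge h₂ h₃⟩

theorem opH_iff_isLift {D : 𝒜 →ₗ[ℂ] 𝒜} (hD : IsStarDerivation D) (h0 : ∀ f, D f = 0 → f = 0)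
    {v a w : Fin n → 𝒜} : opH D v a w ↔ ∃ K, IsLift D v a w K := by
  rw [opH_iff_wedge h0]
  constructor
  · rintro ⟨Q, hQ, rfl⟩
    exact ⟨_, isLift_of_antideriv hD h0 hQ⟩
  · rintro ⟨K, hK⟩
    have hQ := toBlocks₂₂_map_eq_wedgeH hK.antideriv
    exact ⟨_, hQ, hK.unique h0 (isLift_of_antideriv hD h0 hQ)⟩

end Lift

/-! ### Skew-adjointness and Jacobi identity of the pencil from the Leibniz rule. -/

section Covariant

variable {𝒜 : Type*} [NonUnitalCommRing 𝒜] [StarRing 𝒜] [Module ℂ 𝒜] [IsScalarTower ℂ 𝒜 𝒜]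
  [SMulCommClass ℂ 𝒜 𝒜] {n : ℕ}

/-- The derivation `c₁ (D + [v, ·]) + c₂ i` of block matrices, where `i` is `quarterTurn`. -/
def covDeriv (D : 𝒜 →ₗ[ℂ] 𝒜) (v : Fin n → 𝒜) (c₁ c₂ : ℂ) : BlockMat 𝒜 n →ₗ[ℂ] BlockMat 𝒜 n where
  toFun W := c₁ • (D.mapMatrix W + commutator (offDiag v) W) + c₂ • quarterTurn W
  map_add' X Y := by
    simp only [map_add, commutator_add, smul_add]; abel
  map_smul' c X := by
    simp only [map_smul, commutator, Matrix.mul_smul, Matrix.smul_mul, ← smul_sub, ← smul_add,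
      RingHom.id_apply, smul_comm c₁ c, smul_comm c₂ c]

theorem covDeriv_apply (D : 𝒜 →ₗ[ℂ] 𝒜) (v : Fin n → 𝒜) (c₁ c₂ : ℂ) (W : BlockMat 𝒜 n) :
    covDeriv D v c₁ c₂ W =
      c₁ • (D.mapMatrix W + commutator (offDiag v) W) + c₂ • quarterTurn W := rfl

theorem covDeriv_one_zero (D : 𝒜 →ₗ[ℂ] 𝒜) (v : Fin n → 𝒜) (W : BlockMat 𝒜 n) :
    covDeriv D v 1 0 W = D.mapMatrix W + commutator (offDiag v) W := by
  rw [covDeriv_apply, one_smul, zero_smul, add_zero]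

theorem covDeriv_mul {D : 𝒜 →ₗ[ℂ] 𝒜} (hD : IsStarDerivation D) (v : Fin n → 𝒜) (c₁ c₂ : ℂ)
    (X Y : BlockMat 𝒜 n) :
    covDeriv D v c₁ c₂ (X * Y) = covDeriv D v c₁ c₂ X * Y + X * covDeriv D v c₁ c₂ Y := by
  have h : commutator (offDiag v) (X * Y) =
      commutator (offDiag v) X * Y + X * commutator (offDiag v) Y := by
    simp only [commutator, sub_mul, mul_sub, mul_assoc]; abel
  simp only [covDeriv_apply, mapMatrix_mul hD, quarterTurn_mul, h, add_mul, mul_add,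
    Matrix.smul_mul, Matrix.mul_smul, smul_add]
  abel

theorem trace_covDeriv (D : 𝒜 →ₗ[ℂ] 𝒜) (v : Fin n → 𝒜) (c₁ c₂ : ℂ) (W : BlockMat 𝒜 n) :
    trace (covDeriv D v c₁ c₂ W) = c₁ • D (trace W) := by
  rw [covDeriv_apply, trace_add, trace_smul, trace_smul, trace_add, trace_commutator,
    trace_quarterTurn, trace_mapMatrix, smul_zero, add_zero, add_zero]

/-- Only v varies in the operator: D and `quarterTurn` commute with X, so the Fréchet derivative is
a bracket with Xv. -/
theorem mapMatrix_covDeriv {D X : 𝒜 →ₗ[ℂ] 𝒜} (hX : IsEvolutionary D X) (v : Fin n → 𝒜)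
    (c₁ c₂ : ℂ) (W : BlockMat 𝒜 n) :
    X.mapMatrix (covDeriv D v c₁ c₂ W) =
      covDeriv D v c₁ c₂ (X.mapMatrix W) + c₁ • commutator (offDiag (onVec X v)) W := by
  rw [covDeriv_apply, covDeriv_apply, map_add, map_smul, map_smul, map_add, mapMatrix_quarterTurn,
    mapMatrix_comm hX, map_commutator _ (mapMatrix_mul hX.derivation),
    mapMatrix_offDiag hX.derivation, smul_add, smul_add, smul_add]
  abel

theorem trace_mul_covDeriv {D : 𝒜 →ₗ[ℂ] 𝒜} (hD : IsStarDerivation D) (v : Fin n → 𝒜) (c₁ c₂ : ℂ)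
    (X Y : BlockMat 𝒜 n) :
    trace (X * covDeriv D v c₁ c₂ Y) =
      c₁ • D (trace (X * Y)) - trace (covDeriv D v c₁ c₂ X * Y) := by
  rw [← trace_covDeriv D v c₁ c₂, covDeriv_mul hD, trace_add, add_sub_cancel_left]

/-- The pencil `c₁ ℋ + c₂ ℐ` in terms of the covariant derivative of block matrices. -/
def covOper (D : 𝒜 →ₗ[ℂ] 𝒜) (v : Fin n → 𝒜) (c₁ c₂ : ℂ) : Oper 𝒜 n := fun a w =>
  ∃ K, IsBlockDiag K ∧ covDeriv D v c₁ c₂ (offDiag a + K) = offDiag w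

/-- The values being off-diagonal, the parts Ka and Kb can be added to a and b in the pairings at no
cost; the sum is then the trace of the derivation applied to a product. -/
theorem isSkewAdjoint_covOper {D : 𝒜 →ₗ[ℂ] 𝒜} (hD : IsStarDerivation D) (v : Fin n → 𝒜)
    (c₁ c₂ : ℂ) : IsSkewAdjoint D (covOper D v c₁ c₂) := by
  rintro a b wa wb ⟨Ka, hKa, ha⟩ ⟨Kb, hKb, hb⟩
  refine ⟨(-(1 / 2) : ℂ) • c₁ • trace ((offDiag a + Ka) * (offDiag b + Kb)), ?_⟩
  rw [pairing_comm b, pairing_eq_trace_left hKa, pairing_eq_trace_right hKb, ← ha, ← hb,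
    ← smul_add, ← trace_add, add_comm (_ * _), ← covDeriv_mul hD, trace_covDeriv, map_smul,
    map_smul]

/-- Integration by parts: apply B to ∇'W_c = wc and move ∇' onto W_a. The pairing of wa with Bc
cancels the result, and the variation of v leaves a bracket with wb. -/
theorem jacobi_term {D : 𝒜 →ₗ[ℂ] 𝒜} (hD : IsStarDerivation D) {v : Fin n → 𝒜} {c₁ c₂ : ℂ}
    {a c wa wb wc : Fin n → 𝒜} {Ka Kc : BlockMat 𝒜 n} (hKa : IsBlockDiag Ka)
    (hKc : IsBlockDiag Kc)
    (ha : covDeriv D v c₁ c₂ (offDiag a + Ka) = offDiag wa)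
    (hc : covDeriv D v c₁ c₂ (offDiag c + Kc) = offDiag wc)
    {B : 𝒜 →ₗ[ℂ] 𝒜} (hB : IsEvolutionary D B) (hBv : onVec B v = wb) :
    pairing a (onVec B wc) + pairing wa (onVec B c) =
      (-(1 / 2) : ℂ) • c₁ • (D (trace ((offDiag a + Ka) * B.mapMatrix (offDiag c + Kc))) +
        trace ((offDiag a + Ka) * commutator (offDiag wb) (offDiag c + Kc))) := by
  rw [pairing_eq_trace_left hKa, pairing_eq_trace_right (hKc.mapMatrix B),
    ← mapMatrix_offDiag hB.derivation, ← mapMatrix_offDiag hB.derivation, ← map_add, ← ha, ← hc,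
    mapMatrix_covDeriv hB, hBv, mul_add, trace_add, Matrix.mul_smul, trace_smul,
    trace_mul_covDeriv hD, ← smul_add, smul_add c₁]
  congr 1
  abel

theorem jacobi_covOper {D : 𝒜 →ₗ[ℂ] 𝒜} (hD : IsStarDerivation D) (v : Fin n → 𝒜) (c₁ c₂ : ℂ)
    {a b c wa wb wc : Fin n → 𝒜} (ha : covOper D v c₁ c₂ a wa) (hb : covOper D v c₁ c₂ b wb)
    (hc : covOper D v c₁ c₂ c wc) {A B C : 𝒜 →ₗ[ℂ] 𝒜} (hA : IsEvolutionary D A)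
    (hB : IsEvolutionary D B) (hC : IsEvolutionary D C) (hAv : onVec A v = wa)
    (hBv : onVec B v = wb) (hCv : onVec C v = wc) :
    IsTotalDerivative D
      ((pairing a (onVec B wc) + pairing wa (onVec B c)) +
       (pairing b (onVec C wa) + pairing wb (onVec C a)) +
       (pairing c (onVec A wb) + pairing wc (onVec A b))) := by
  obtain ⟨Ka, hKa, ha⟩ := ha
  obtain ⟨Kb, hKb, hb⟩ := hb
  obtain ⟨Kc, hKc, hc⟩ := hc
  rw [jacobi_term hD hKa hKc ha hc hB hBv, jacobi_term hD hKb hKa hb ha hC hCv,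
    jacobi_term hD hKc hKb hc hb hA hAv]
  generalize offDiag a + Ka = Wa at *
  generalize offDiag b + Kb = Wb at *
  generalize offDiag c + Kc = Wc at *
  -- The three terms are the Leibniz expansion of the derivation on Wa [Wb, Wc], rearranged by
  -- ad-invariance.
  have key : trace (Wa * commutator (offDiag wb) Wc) + trace (Wb * commutator (offDiag wc) Wa) +
      trace (Wc * commutator (offDiag wa) Wb) = c₁ • D (trace (Wa * commutator Wb Wc)) := by
    rw [← trace_covDeriv D v c₁ c₂, covDeriv_mul hD, map_commutator _ (covDeriv_mul hD v c₁ c₂),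
      ha, hb, hc, mul_add, trace_add, trace_add, ← trace_commutator_mul Wb, trace_mul_comm _ Wa,
      trace_mul_comm Wc, trace_commutator_mul (offDiag wa)]
    abel
  refine ⟨(-(1 / 2) : ℂ) • c₁ • (trace (Wa * B.mapMatrix Wc) + trace (Wb * C.mapMatrix Wa) +
    trace (Wc * A.mapMatrix Wb) + c₁ • trace (Wa * commutator Wb Wc)), ?_⟩
  rw [map_smul, map_smul, map_add, map_smul, ← key, map_add, map_add, ← smul_add, ← smul_add,
    ← smul_add, ← smul_add]
  congr 2
  abel

theorem IsLift.covDeriv_one_zero {D : 𝒜 →ₗ[ℂ] 𝒜} (hD : IsStarDerivation D) {v a w : Fin n → 𝒜}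
    {K : BlockMat 𝒜 n} (h : IsLift D v a w K) :
    CurveFlow.covDeriv D v 1 0 (offDiag a + K) = offDiag w := by
  rw [CurveFlow.covDeriv_one_zero, h.covariant hD]

end Covariant

/-! ### Partially defined real-linear operators; elementary facts about i. -/

section PartialLinear

variable {𝒜 : Type*} [NonUnitalCommRing 𝒜] [Module ℂ 𝒜] {n : ℕ}

theorem onVec_add (D : 𝒜 →ₗ[ℂ] 𝒜) (a b : Fin n → 𝒜) : onVec D (a + b) = onVec D a + onVec D b := by
  ext j; simp [onVec]

theorem onVec_smul (D : 𝒜 →ₗ[ℂ] 𝒜) (c : ℂ) (a : Fin n → 𝒜) :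
    onVec D (c • a) = c • onVec D a := by
  ext j; simp [onVec]

theorem onVec_sub (D : 𝒜 →ₗ[ℂ] 𝒜) (a b : Fin n → 𝒜) : onVec D (a - b) = onVec D a - onVec D b := by
  ext j; simp [onVec]

theorem IsTotalDerivative.add {D : 𝒜 →ₗ[ℂ] 𝒜} {f g : 𝒜} (hf : IsTotalDerivative D f)
    (hg : IsTotalDerivative D g) : IsTotalDerivative D (f + g) := by
  obtain ⟨p, rfl⟩ := hf
  obtain ⟨q, rfl⟩ := hg
  exact ⟨p + q, map_add _ _ _⟩

theorem IsTotalDerivative.smul {D : 𝒜 →ₗ[ℂ] 𝒜} {f : 𝒜} (hf : IsTotalDerivative D f) (c : ℂ) :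
    IsTotalDerivative D (c • f) := by
  obtain ⟨p, rfl⟩ := hf
  exact ⟨c • p, map_smul _ _ _⟩

theorem isTotalDerivative_zero (D : 𝒜 →ₗ[ℂ] 𝒜) : IsTotalDerivative D 0 := ⟨0, map_zero _⟩

theorem IsPartialLinear.pencil {S T : Oper 𝒜 n} (hS : IsPartialLinear S) (hT : IsPartialLinear T)
    (c₁ c₂ : ℝ) : IsPartialLinear (pencil c₁ c₂ S T) where
  unique := by
    rintro a w w' ⟨p, q, hp, hq, rfl⟩ ⟨p', q', hp', hq', rfl⟩
    rw [hS.unique _ _ _ hp hp', hT.unique _ _ _ hq hq']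
  add := by
    rintro a b w w' ⟨p, q, hp, hq, rfl⟩ ⟨p', q', hp', hq', rfl⟩
    exact ⟨_, _, hS.add _ _ _ _ hp hp', hT.add _ _ _ _ hq hq', by
      simp only [smul_add]; abel⟩
  smul := by
    rintro c a w ⟨p, q, hp, hq, rfl⟩
    exact ⟨_, _, hS.smul c _ _ hp, hT.smul c _ _ hq, by
      simp only [smul_add, smul_comm (c : ℂ)]⟩

theorem IsPartialLinear.comp {S T : Oper 𝒜 n} (hS : IsPartialLinear S) (hT : IsPartialLinear T) :
    IsPartialLinear (comp S T) where
  unique := by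
    rintro a w w' ⟨u, hu, hw⟩ ⟨u', hu', hw'⟩
    rw [hT.unique _ _ _ hu hu'] at hw
    exact hS.unique _ _ _ hw hw'
  add := by
    rintro a b w w' ⟨u, hu, hw⟩ ⟨u', hu', hw'⟩
    exact ⟨_, hT.add _ _ _ _ hu hu', hS.add _ _ _ _ hw hw'⟩
  smul := by
    rintro c a w ⟨u, hu, hw⟩
    exact ⟨_, hT.smul c _ _ hu, hS.smul c _ _ hw⟩

theorem isPartialLinear_opI : IsPartialLinear (opI (𝒜 := 𝒜) (n := n)) where
  unique := by rintro a w w' rfl rfl; rfl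
  add := by rintro a b w w' rfl rfl; exact (smul_add _ _ _).symm
  smul := by rintro c a w rfl; exact smul_comm _ _ _

theorem isPartialLinear_opNegI : IsPartialLinear (opNegI (𝒜 := 𝒜) (n := n)) where
  unique := by rintro a w w' rfl rfl; rfl
  add := by
    rintro a b w w' rfl rfl
    rw [opNegI, smul_add, neg_add]
  smul := by
    rintro c a w rfl
    rw [opNegI, smul_neg, smul_comm]

theorem I_smul_I_smul (a : Fin n → 𝒜) : Complex.I • Complex.I • a = -a := by
  rw [smul_smul, Complex.I_mul_I, neg_one_smul]

theorem I_smul_injective : Function.Injective fun a : Fin n → 𝒜 => Complex.I • a := by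
  intro a b h
  have := congrArg (fun a => Complex.I • a) h
  simpa only [I_smul_I_smul, neg_inj] using this

theorem inv_opI : inv (opI (𝒜 := 𝒜) (n := n)) = opNegI := by
  ext a w
  constructor
  · rintro rfl
    rw [opNegI, I_smul_I_smul, neg_neg]
  · rintro rfl
    rw [inv, opI, smul_neg, I_smul_I_smul, neg_neg]

theorem pencil_one_zero (S : Oper 𝒜 n) : pencil 1 0 S opI = S := by
  ext a w
  constructor
  · rintro ⟨w₁, w₂, h, -, rfl⟩
    simpa using h
  · exact fun h => ⟨w, _, h, rfl, by simp⟩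

theorem commutator_smul [IsScalarTower ℂ 𝒜 𝒜] [SMulCommClass ℂ 𝒜 𝒜] (c : ℂ)
    (X Y : BlockMat 𝒜 n) :
    commutator X (c • Y) = c • commutator X Y := by
  simp only [commutator, Matrix.mul_smul, Matrix.smul_mul, smul_sub]

theorem smul_commutator [IsScalarTower ℂ 𝒜 𝒜] [SMulCommClass ℂ 𝒜 𝒜] (c : ℂ)
    (X Y : BlockMat 𝒜 n) :
    commutator (c • X) Y = c • commutator X Y := by
  rw [commutator_swap, commutator_smul, commutator_swap Y, smul_neg, neg_neg]

end PartialLinear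

/-! ### ℋ and ℐ as a Hamiltonian pair; 𝒥 and ℛ in terms of ℋ. -/

section Operators

variable {𝒜 : Type*} [NonUnitalCommRing 𝒜] [StarRing 𝒜] [Module ℂ 𝒜] {n : ℕ}

theorem pairing_add (a b c : Fin n → 𝒜) : pairing a (b + c) = pairing a b + pairing a c := by
  simp only [pairing_eq_trace, offDiag_add, mul_add, trace_add, smul_add]

theorem add_pairing (a b c : Fin n → 𝒜) : pairing (a + b) c = pairing a c + pairing b c := by
  simp only [pairing_eq_trace, offDiag_add, add_mul, trace_add, smul_add]

theorem neg_pairing (a b : Fin n → 𝒜) : pairing (-a) b = -pairing a b := by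
  simp only [pairing_eq_trace, offDiag_neg, neg_mul, trace_neg, smul_neg]

theorem pairing_neg (a b : Fin n → 𝒜) : pairing a (-b) = -pairing a b := by
  simp only [pairing_eq_trace, offDiag_neg, mul_neg, trace_neg, smul_neg]

theorem sub_pairing (a b c : Fin n → 𝒜) : pairing (a - b) c = pairing a c - pairing b c := by
  rw [sub_eq_add_neg, add_pairing, neg_pairing, sub_eq_add_neg]

theorem dotH_neg (a b : Fin n → 𝒜) : dotH a (-b) = -dotH a b := by
  simp [dotH, add_comm]

theorem pairing_smul [SMulCommClass ℂ 𝒜 𝒜] [StarModule ℂ 𝒜] (c : ℝ) (a b : Fin n → 𝒜) :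
    pairing a ((c : ℂ) • b) = (c : ℂ) • pairing a b := by
  rw [pairing_eq_trace, pairing_eq_trace, offDiag_smul, Matrix.mul_smul, trace_smul, smul_comm]

theorem map_pairing {X : 𝒜 →ₗ[ℂ] 𝒜} (hX : IsStarDerivation X) (a b : Fin n → 𝒜) :
    X (pairing a b) = pairing (onVec X a) b + pairing a (onVec X b) := by
  simp only [pairing_eq_trace, map_smul, ← trace_mapMatrix, mapMatrix_mul hX,
    mapMatrix_offDiag hX, trace_add, smul_add]

theorem IsLift.add {D : 𝒜 →ₗ[ℂ] 𝒜} {v a b w u : Fin n → 𝒜} {K L : BlockMat 𝒜 n}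
    (h : IsLift D v a w K) (h' : IsLift D v b u L) : IsLift D v (a + b) (w + u) (K + L) where
  blockDiag := h.blockDiag.add h'.blockDiag
  antideriv := by
    rw [map_add, offDiag_add, commutator_add, ← add_zero (0 : BlockMat 𝒜 n)]
    nth_rw 2 [← h'.antideriv]
    rw [← h.antideriv]
    abel
  value := by
    rw [onVec_add, offDiag_add, commutator_add, offDiag_add, ← h.value, ← h'.value]
    abel

theorem IsLift.mapMatrix_value {D X : 𝒜 →ₗ[ℂ] 𝒜} (hX : IsEvolutionary D X)
    {v y w : Fin n → 𝒜} {K : BlockMat 𝒜 n} (h : IsLift D v (Complex.I • y) w K) :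
    offDiag (onVec D (Complex.I • onVec X y)) + commutator (offDiag (onVec X v)) K +
      commutator (offDiag v) (X.mapMatrix K) = offDiag (onVec X w) := by
  have hc : onVec D (Complex.I • onVec X y) = onVec X (onVec D (Complex.I • y)) := by
    rw [← onVec_smul]; ext j; exact (hX.comm _).symm
  rw [hc, ← mapMatrix_offDiag hX.derivation w, ← h.value, map_add,
    map_commutator _ (mapMatrix_mul hX.derivation), mapMatrix_offDiag hX.derivation,
    mapMatrix_offDiag hX.derivation, add_assoc]

variable [IsScalarTower ℂ 𝒜 𝒜] [SMulCommClass ℂ 𝒜 𝒜] [StarModule ℂ 𝒜]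

theorem IsLift.smul {D : 𝒜 →ₗ[ℂ] 𝒜} {v a w : Fin n → 𝒜} {K : BlockMat 𝒜 n}
    (h : IsLift D v a w K) (c : ℝ) :
    IsLift D v ((c : ℂ) • a) ((c : ℂ) • w) ((c : ℂ) • K) where
  blockDiag := by
    rw [h.blockDiag.eq, fromBlocks_smul, smul_zero, smul_zero]
    exact isBlockDiag_fromBlocks _ _
  antideriv := by
    rw [map_smul, offDiag_smul, commutator_smul, ← smul_add, h.antideriv, smul_zero]
  value := by
    rw [onVec_smul, offDiag_smul, offDiag_smul, commutator_smul, ← smul_add, h.value]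

/-- `quarterTurn` is a derivation with traceless values, hence skew for the trace form. -/
theorem pairing_I_smul (a b : Fin n → 𝒜) :
    pairing (Complex.I • a) b = -pairing a (Complex.I • b) := by
  have := trace_quarterTurn (offDiag a * offDiag b)
  rw [quarterTurn_mul, trace_add, quarterTurn_offDiag, quarterTurn_offDiag] at this
  rw [pairing_eq_trace, pairing_eq_trace, eq_neg_of_add_eq_zero_left this, smul_neg]

theorem pairing_I_smul_I_smul (a b : Fin n → 𝒜) :
    pairing (Complex.I • a) (Complex.I • b) = pairing a b := by
  rw [pairing_I_smul, I_smul_I_smul, pairing_neg, neg_neg]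

theorem wedgeH_I_smul (a b : Fin n → 𝒜) : wedgeH a (Complex.I • b) = Complex.I • symH a b := by
  simp only [symH, wedgeH, vecMulVec_smul, star_smul, smul_vecMulVec, smul_add]
  simp [sub_eq_add_neg]

/-- `i 𝒥(a) = ℋ(i a)`, with the corresponding antiderivatives. -/
theorem isValueJ_iff {D : 𝒜 →ₗ[ℂ] 𝒜} {v a w : Fin n → 𝒜} {s : 𝒜} {P : Matrix (Fin n) (Fin n) 𝒜} :
    IsValueJ D v a s P w ↔
      IsValueH D v (Complex.I • a) (-s) (Complex.I • P) (Complex.I • w) := by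
  -- The sign of s flips because i² = -1, while i times a Hermitian symmetric product is a wedge
  -- product.
  have h₁ : D (-s) = dotH (star v) (Complex.I • Complex.I • a) ↔ D s = dotH (star v) a := by
    rw [I_smul_I_smul, dotH_neg, map_neg, neg_inj]
  have h₂ : (Complex.I • P).map D = wedgeH (star v) (Complex.I • a) ↔
      P.map D = symH (star v) a := by
    rw [wedgeH_I_smul, Matrix.map_smul _ _ (fun x => map_smul D _ x)]
    exact (smul_right_injective _ Complex.I_ne_zero).eq_iff
  have h₃ : Complex.I • w = onVec D (Complex.I • a) -
      (fun j => (2 * Complex.I) • (-s * v j)) + v ᵥ* (Complex.I • P) ↔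
      w = onVec D a + (fun j => (2 : ℂ) • (s * v j)) + v ᵥ* P := by
    have : onVec D (Complex.I • a) -
      (fun j => (2 * Complex.I) • (-s * v j)) + v ᵥ* (Complex.I • P) =
      Complex.I • (onVec D a + (fun j => (2 : ℂ) • (s * v j)) + v ᵥ* P) := by
      rw [onVec_smul, vecMul_smul, smul_add, smul_add]
      ext j
      simp [smul_smul, mul_comm]
    rw [this]
    exact I_smul_injective.eq_iff
  exact ⟨fun h => ⟨h₁.2 h.1, h₂.2 h.2, h₃.2 h.3⟩, fun h => ⟨h₁.1 h.1, h₂.1 h.2, h₃.1 h.3⟩⟩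

theorem opJ_iff {D : 𝒜 →ₗ[ℂ] 𝒜} {v a w : Fin n → 𝒜} :
    opJ D v a w ↔ opH D v (Complex.I • a) (Complex.I • w) := by
  constructor
  · rintro ⟨s, P, h⟩
    exact ⟨_, _, isValueJ_iff.1 h⟩
  · rintro ⟨s, Q, h⟩
    refine ⟨-s, -(Complex.I • Q), isValueJ_iff.2 ?_⟩
    rwa [neg_neg, smul_neg, smul_smul, Complex.I_mul_I, neg_one_smul, neg_neg]

theorem opJ_eq_comp (D : 𝒜 →ₗ[ℂ] 𝒜) (v : Fin n → 𝒜) :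
    opJ D v = comp (inv opI) (comp (opH D v) opI) := by
  ext a w
  rw [opJ_iff]
  constructor
  · exact fun h => ⟨_, ⟨_, rfl, h⟩, rfl⟩
  · rintro ⟨_, ⟨_, rfl, h⟩, rfl⟩
    exact h

theorem opR_eq_comp (D : 𝒜 →ₗ[ℂ] 𝒜) (v : Fin n → 𝒜) : opR D v = comp opI (opJ D v) := by
  ext a w
  constructor
  · rintro ⟨_, rfl, h⟩
    refine ⟨-(Complex.I • w), opJ_iff.2 ?_, ?_⟩
    · rwa [smul_neg, I_smul_I_smul, neg_neg]
    · rw [opI, smul_neg, I_smul_I_smul, neg_neg]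
  · rintro ⟨u, h, rfl⟩
    exact ⟨_, rfl, opJ_iff.1 h⟩

theorem isPartialLinear_opH {D : 𝒜 →ₗ[ℂ] 𝒜} (hD : IsStarDerivation D) (h0 : ∀ f, D f = 0 → f = 0)
    (v : Fin n → 𝒜) : IsPartialLinear (opH D v) where
  unique a w w' h h' := by
    rw [opH_iff_isLift hD h0] at h h'
    obtain ⟨K, h⟩ := h
    obtain ⟨K', h'⟩ := h'
    exact h.unique h0 h'
  add a b w u h h' := by
    rw [opH_iff_isLift hD h0] at h h' ⊢
    obtain ⟨K, h⟩ := h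
    obtain ⟨K', h'⟩ := h'
    exact ⟨_, h.add h'⟩
  smul c a w h := by
    rw [opH_iff_isLift hD h0] at h ⊢
    obtain ⟨K, h⟩ := h
    exact ⟨_, h.smul c⟩

theorem IsLift.covDeriv {D : 𝒜 →ₗ[ℂ] 𝒜} (hD : IsStarDerivation D) {v a w : Fin n → 𝒜}
    {K : BlockMat 𝒜 n} (h : IsLift D v a w K) (c₁ c₂ : ℝ) :
    covDeriv D v c₁ c₂ (offDiag a + K) =
      offDiag ((c₁ : ℂ) • w + (c₂ : ℂ) • (Complex.I • a)) := by
  rw [covDeriv_apply, h.covariant hD, map_add, quarterTurn_of_diag h.blockDiag, add_zero,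
    quarterTurn_offDiag, offDiag_add, offDiag_smul, offDiag_smul]

/-- One direction suffices, since skew-adjointness and the Jacobi identity pass to smaller graphs.
For c₁ = 0 the inclusion can be strict: the pencil still requires ℋ(a) to exist. -/
theorem covOper_of_pencil {D : 𝒜 →ₗ[ℂ] 𝒜} (hD : IsStarDerivation D) (h0 : ∀ f, D f = 0 → f = 0)
    {v a w : Fin n → 𝒜} {c₁ c₂ : ℝ} (h : pencil c₁ c₂ (opH D v) opI a w) :
    covOper D v c₁ c₂ a w := by
  obtain ⟨w₁, w₂, h₁, rfl, rfl⟩ := h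
  obtain ⟨K, hK⟩ := (opH_iff_isLift hD h0).1 h₁
  exact ⟨K, hK.blockDiag, hK.covDeriv hD c₁ c₂⟩

theorem isCosymplectic_pencil {D : 𝒜 →ₗ[ℂ] 𝒜} (hD : IsStarDerivation D)
    (h0 : ∀ f, D f = 0 → f = 0) (v : Fin n → 𝒜) (c₁ c₂ : ℝ) :
    IsCosymplectic D v (pencil c₁ c₂ (opH D v) opI) where
  partialLinear := (isPartialLinear_opH hD h0 v).pencil isPartialLinear_opI c₁ c₂
  skew _ _ _ _ ha hb := isSkewAdjoint_covOper hD v c₁ c₂ _ _ _ _ (covOper_of_pencil hD h0 ha)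
    (covOper_of_pencil hD h0 hb)
  jacobi _ _ _ _ _ _ ha hb hc _ _ _ hA hB hC hAv hBv hCv :=
    jacobi_covOper hD v c₁ c₂ (covOper_of_pencil hD h0 ha) (covOper_of_pencil hD h0 hb)
      (covOper_of_pencil hD h0 hc) hA hB hC hAv hBv hCv

/-- Not the case (0, 1) of the pencil, whose domain is only that of ℋ. Constancy of ℐ makes each
Jacobi term vanish separately. -/
theorem isCosymplectic_opI (D : 𝒜 →ₗ[ℂ] 𝒜) (v : Fin n → 𝒜) :
    IsCosymplectic D v (opI (𝒜 := 𝒜) (n := n)) where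
  partialLinear := isPartialLinear_opI
  skew := by
    rintro a b _ _ rfl rfl
    rw [pairing_comm b, pairing_I_smul, add_neg_cancel]
    exact isTotalDerivative_zero D
  jacobi := by
    rintro a b c _ _ _ rfl rfl rfl A B C hA hB hC - - -
    simp only [onVec_smul, pairing_I_smul, add_neg_cancel, add_zero]
    exact isTotalDerivative_zero D

theorem isHamiltonianPair_opH_opI {D : 𝒜 →ₗ[ℂ] 𝒜} (hD : IsStarDerivation D)
    (h0 : ∀ f, D f = 0 → f = 0) (v : Fin n → 𝒜) : IsHamiltonianPair D v (opH D v) opI where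
  left := by simpa only [pencil_one_zero] using isCosymplectic_pencil hD h0 v 1 0
  right := isCosymplectic_opI D v
  pencil := isCosymplectic_pencil hD h0 v

end Operators

/-! ### Closedness of the 2-forms and vanishing Nijenhuis torsion. -/

section Symplectic

variable {𝒜 : Type*} [NonUnitalCommRing 𝒜] [StarRing 𝒜] {n : ℕ}

/-- By parity, only the terms with exactly one block diagonal factor have nonzero trace. -/
theorem trace_mul_commutator_of_diag {K L : BlockMat 𝒜 n} (hK : IsBlockDiag K)
    (hL : IsBlockDiag L) (x y z : Fin n → 𝒜) :
    trace ((offDiag y + K) * commutator (offDiag x) (offDiag z + L)) =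
      trace (K * commutator (offDiag x) (offDiag z)) +
        trace (L * commutator (offDiag y) (offDiag x)) := by
  rw [commutator_add, add_mul, mul_add, mul_add, trace_add, trace_add, trace_add,
    trace_off_mul_diag (isBlockOff_offDiag y)
      ((isBlockOff_offDiag x).commutator (isBlockOff_offDiag z)),
    trace_diag_mul_off hK ((isBlockOff_offDiag x).commutator_diag hL), zero_add, add_zero,
    ← trace_commutator_mul, trace_mul_comm _ L, add_comm]

variable [Module ℂ 𝒜] [SMulCommClass ℂ 𝒜 𝒜] [StarModule ℂ 𝒜]

theorem IsSymplectic.pencil {D : 𝒜 →ₗ[ℂ] 𝒜} {v : Fin n → 𝒜} {S T : Oper 𝒜 n}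
    (hS : IsSymplectic D v S) (hT : IsSymplectic D v T) (c₁ c₂ : ℝ) :
    IsSymplectic D v (pencil c₁ c₂ S T) where
  partialLinear := hS.partialLinear.pencil hT.partialLinear c₁ c₂
  skew := by
    rintro a b _ _ ⟨p, q, hp, hq, rfl⟩ ⟨p', q', hp', hq', rfl⟩
    convert ((hS.skew _ _ _ _ hp hp').smul c₁).add ((hT.skew _ _ _ _ hq hq').smul c₂) using 1
    simp only [pairing_add, pairing_smul, smul_add]
    abel
  closed := by
    rintro X Y Z hX hY hZ _ _ _ ⟨x, x', hx, hx', rfl⟩ ⟨y, y', hy, hy', rfl⟩ ⟨z, z', hz, hz', rfl⟩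
    convert ((hS.closed _ _ _ hX hY hZ _ _ _ hx hy hz).smul c₁).add
      ((hT.closed _ _ _ hX hY hZ _ _ _ hx' hy' hz').smul c₂) using 1
    simp only [pairing_add, pairing_smul, smul_add, smul_sub, map_add, map_smul]
    abel

variable [IsScalarTower ℂ 𝒜 𝒜]

/-- The left side is `quarterTurn` of [a, b], and the bracket of two off-diagonal matrices is block
diagonal. -/
theorem commutator_I_smul_add (a b : Fin n → 𝒜) :
    commutator (offDiag (Complex.I • a)) (offDiag b) +
      commutator (offDiag a) (offDiag (Complex.I • b)) = 0 := by
  rw [← quarterTurn_offDiag, ← quarterTurn_offDiag, ← map_commutator _ quarterTurn_mul,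
    quarterTurn_of_diag ((isBlockOff_offDiag a).commutator (isBlockOff_offDiag b))]

theorem cyclic_trace_eq_zero {Kx Ky Kz : BlockMat 𝒜 n} (hx : IsBlockDiag Kx)
    (hy : IsBlockDiag Ky) (hz : IsBlockDiag Kz) (x y z : Fin n → 𝒜) :
    trace ((offDiag (Complex.I • y) + Ky) *
        commutator (offDiag x) (offDiag (Complex.I • z) + Kz)) +
      trace ((offDiag (Complex.I • z) + Kz) *
        commutator (offDiag y) (offDiag (Complex.I • x) + Kx)) +
      trace ((offDiag (Complex.I • x) + Kx) *
        commutator (offDiag z) (offDiag (Complex.I • y) + Ky)) = 0 := by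
  rw [trace_mul_commutator_of_diag hy hz, trace_mul_commutator_of_diag hz hx,
    trace_mul_commutator_of_diag hx hy]
  have h : ∀ (K : BlockMat 𝒜 n) (a b : Fin n → 𝒜),
      trace (K * commutator (offDiag (Complex.I • a)) (offDiag b)) =
        -trace (K * commutator (offDiag a) (offDiag (Complex.I • b))) := by
    intro K a b
    rw [eq_neg_of_add_eq_zero_left (commutator_I_smul_add a b), mul_neg, trace_neg]
  rw [h, h, h]
  abel

/-- The integration by parts of `jacobi_term`, for lifts of i y and i z. In the cyclic sum the first
two terms cancel against the brackets of vector fields, the derivative is harmless, and the last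
traces add up to zero. -/
theorem map_pairing_opJ {D X : 𝒜 →ₗ[ℂ] 𝒜} (hD : IsStarDerivation D) (hX : IsEvolutionary D X)
    {v y z wy wz : Fin n → 𝒜} {Ky Kz : BlockMat 𝒜 n}
    (hy : IsLift D v (Complex.I • y) (Complex.I • wy) Ky)
    (hz : IsLift D v (Complex.I • z) (Complex.I • wz) Kz) :
    X (pairing y wz) = pairing (onVec X y) wz - pairing (onVec X z) wy +
      (-(1 / 2) : ℂ) •
        (D (trace ((offDiag (Complex.I • y) + Ky) *
          X.mapMatrix (offDiag (Complex.I • z) + Kz))) +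
        trace ((offDiag (Complex.I • y) + Ky) *
          commutator (offDiag (onVec X v)) (offDiag (Complex.I • z) + Kz))) := by
  have h₁ : pairing (onVec X z) wy = (-(1 / 2) : ℂ) • trace (offDiag (Complex.I • wy) *
      X.mapMatrix (offDiag (Complex.I • z) + Kz)) := by
    rw [map_add, mapMatrix_offDiag hX.derivation, onVec_smul,
      ← pairing_eq_trace_right (hz.blockDiag.mapMatrix X), pairing_I_smul_I_smul, pairing_comm]
  rw [map_pairing hX.derivation, h₁, ← pairing_I_smul_I_smul y,
    pairing_eq_trace_left hy.blockDiag (Complex.I • y),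
    ← onVec_smul, ← mapMatrix_offDiag hX.derivation, ← hz.covDeriv_one_zero hD,
    ← hy.covDeriv_one_zero hD, mapMatrix_covDeriv hX, mul_add, trace_add,
    trace_mul_covDeriv hD, one_smul, one_smul]
  simp only [smul_add, smul_sub]
  abel

theorem isSymplectic_opJ {D : 𝒜 →ₗ[ℂ] 𝒜} (hD : IsStarDerivation D)
    (h0 : ∀ f, D f = 0 → f = 0) (v : Fin n → 𝒜) : IsSymplectic D v (opJ D v) where
  partialLinear := by
    rw [opJ_eq_comp, inv_opI]
    exact isPartialLinear_opNegI.comp ((isPartialLinear_opH hD h0 v).comp isPartialLinear_opI)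
  skew a b wa wb ha hb := by
    rw [← pairing_I_smul_I_smul a, ← pairing_I_smul_I_smul b]
    exact (isHamiltonianPair_opH_opI hD h0 v).left.skew _ _ _ _ (opJ_iff.1 ha) (opJ_iff.1 hb)
  closed X Y Z hX hY hZ wX wY wZ hwX hwY hwZ := by
    obtain ⟨KX, hKX⟩ := (opH_iff_isLift hD h0).1 (opJ_iff.1 hwX)
    obtain ⟨KY, hKY⟩ := (opH_iff_isLift hD h0).1 (opJ_iff.1 hwY)
    obtain ⟨KZ, hKZ⟩ := (opH_iff_isLift hD h0).1 (opJ_iff.1 hwZ)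
    rw [map_pairing_opJ hD hX hKY hKZ, map_pairing_opJ hD hY hKZ hKX,
      map_pairing_opJ hD hZ hKX hKY]
    have key := cyclic_trace_eq_zero hKX.blockDiag hKY.blockDiag hKZ.blockDiag (onVec X v)
      (onVec Y v) (onVec Z v)
    simp only [bracket, sub_pairing]
    refine ⟨(-(1 / 2) : ℂ) • (
      trace ((offDiag (Complex.I • onVec Y v) + KY) *
        X.mapMatrix (offDiag (Complex.I • onVec Z v) + KZ)) +
      trace ((offDiag (Complex.I • onVec Z v) + KZ) *
        Y.mapMatrix (offDiag (Complex.I • onVec X v) + KX)) +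
      trace ((offDiag (Complex.I • onVec X v) + KX) *
        Z.mapMatrix (offDiag (Complex.I • onVec Y v) + KY))), ?_⟩
    have key' := congrArg (fun f => (-(1 / 2) : ℂ) • f) key
    simp only [smul_add, smul_zero] at key'
    simp only [map_smul, map_add, smul_add]
    linear_combination (norm := abel) -key'

theorem isSymplectic_opNegI (D : 𝒜 →ₗ[ℂ] 𝒜) (v : Fin n → 𝒜) :
    IsSymplectic D v (opNegI (𝒜 := 𝒜) (n := n)) where
  partialLinear := isPartialLinear_opNegI
  skew := by
    rintro a b _ _ rfl rfl
    rw [pairing_neg, pairing_neg, pairing_comm b, pairing_I_smul, ← neg_add, add_neg_cancel,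
      neg_zero]
    exact isTotalDerivative_zero D
  closed := by
    rintro X Y Z hX hY hZ _ _ _ rfl rfl rfl
    simp only [bracket, sub_pairing, pairing_neg, map_neg, map_pairing hX.derivation,
      map_pairing hY.derivation, map_pairing hZ.derivation, onVec_smul]
    rw [pairing_comm (onVec Y v), pairing_comm (onVec Z v), pairing_comm (onVec X v)]
    simp only [pairing_I_smul]
    refine ⟨0, ?_⟩
    rw [map_zero]
    abel

/-- The characteristic of a commutator is in the domain of `ℋ ∘ ℐ` if those of its factors are. -/
theorem antideriv_bracket {D X Y : 𝒜 →ₗ[ℂ] 𝒜} (hX : IsEvolutionary D X)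
    (hY : IsEvolutionary D Y) {v wX wY : Fin n → 𝒜} {KX KY : BlockMat 𝒜 n}
    (hKX : IsLift D v (Complex.I • onVec X v) wX KX)
    (hKY : IsLift D v (Complex.I • onVec Y v) wY KY) :
    D.mapMatrix (X.mapMatrix KY - Y.mapMatrix KX) +
      commutator (offDiag v) (offDiag (Complex.I • bracket v X Y)) = 0 := by
  have h₁ := congrArg X.mapMatrix hKY.antideriv
  have h₂ := congrArg Y.mapMatrix hKX.antideriv
  -- This cancels the terms in which X and Y differentiate the v of ad(v).
  have h₃ := commutator_I_smul_add (onVec X v) (onVec Y v)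
  rw [map_zero, map_add, mapMatrix_comm hX, map_commutator _ (mapMatrix_mul hX.derivation),
    mapMatrix_offDiag hX.derivation, mapMatrix_offDiag hX.derivation, onVec_smul] at h₁
  rw [map_zero, map_add, mapMatrix_comm hY, map_commutator _ (mapMatrix_mul hY.derivation),
    mapMatrix_offDiag hY.derivation, mapMatrix_offDiag hY.derivation, onVec_smul,
    commutator_swap (offDiag (onVec Y v))] at h₂
  rw [bracket, smul_sub, offDiag_sub, commutator_sub, map_sub]
  linear_combination (norm := abel) h₁ - h₂ - h₃

theorem quarterTurn_commutator {K : BlockMat 𝒜 n} (hK : IsBlockDiag K) (a : Fin n → 𝒜) :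
    quarterTurn (commutator (offDiag a) K) = commutator (offDiag (Complex.I • a)) K := by
  rw [map_commutator _ quarterTurn_mul, quarterTurn_of_diag hK, quarterTurn_offDiag]
  simp [commutator]

theorem isHereditary_opR {D : 𝒜 →ₗ[ℂ] 𝒜} (hD : IsStarDerivation D)
    (h0 : ∀ f, D f = 0 → f = 0) (v : Fin n → 𝒜) : IsHereditary D v (opR D v) where
  partialLinear := (isPartialLinear_opH hD h0 v).comp isPartialLinear_opI
  torsion := by
    rintro X Y TX TY hX hY hTX hTY ⟨_, rfl, h₁⟩ ⟨_, rfl, h₂⟩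
    obtain ⟨KX, hKX⟩ := (opH_iff_isLift hD h0).1 h₁
    obtain ⟨KY, hKY⟩ := (opH_iff_isLift hD h0).1 h₂
    obtain ⟨u, hu⟩ := exists_isLift hD h0 (antideriv_bracket hX hY hKX hKY)
    refine ⟨u, ⟨_, rfl, (opH_iff_isLift hD h0).2 ⟨_, hu⟩⟩, ⟨_, rfl, ?_⟩⟩
    -- From here on the derivatives of TX v and TY v along Y and X drop out of the torsion argument,
    -- leaving only brackets with KX and KY.
    have eu : offDiag u = offDiag (onVec X (onVec TY v)) - offDiag (onVec Y (onVec TX v)) -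
        commutator (offDiag (onVec X v)) KY + commutator (offDiag (onVec Y v)) KX := by
      have e₁ := hKY.mapMatrix_value hX
      have e₂ := hKX.mapMatrix_value hY
      have e₃ := hu.value
      rw [bracket, smul_sub, onVec_sub, offDiag_sub, commutator_sub] at e₃
      linear_combination (norm := abel) e₁ - e₂ - e₃
    have eo : offDiag (Complex.I • (bracket v TX Y + bracket v X TY - u)) =
        offDiag (onVec TX (Complex.I • onVec Y v)) - offDiag (onVec TY (Complex.I • onVec X v)) +
          commutator (offDiag (Complex.I • onVec X v)) KY -
          commutator (offDiag (Complex.I • onVec Y v)) KX := by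
      rw [onVec_smul, onVec_smul, ← quarterTurn_commutator hKY.blockDiag,
        ← quarterTurn_commutator hKX.blockDiag, ← quarterTurn_offDiag, ← quarterTurn_offDiag,
        ← quarterTurn_offDiag, ← map_sub, ← map_add, ← map_sub, offDiag_sub, offDiag_add, bracket,
        bracket, offDiag_sub, offDiag_sub, eu]
      congr 1
      abel
    -- The witness is the block diagonal part of TX(W_Y) - TY(W_X) + [W_X, W_Y].
    refine (opH_iff_isLift hD h0).2 ⟨TX.mapMatrix KY - TY.mapMatrix KX +
      commutator (offDiag (Complex.I • onVec X v)) (offDiag (Complex.I • onVec Y v)) +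
      commutator KX KY, isLift_of_covariant hD ?_ ?_⟩
    · exact (((hKY.blockDiag.mapMatrix TX).sub (hKX.blockDiag.mapMatrix TY)).add
        ((isBlockOff_offDiag _).commutator (isBlockOff_offDiag _))).add
        (hKX.blockDiag.commutator hKY.blockDiag)
    · rw [← covDeriv_one_zero]
      have eW : offDiag (Complex.I • (bracket v TX Y + bracket v X TY - u)) +
          (TX.mapMatrix KY - TY.mapMatrix KX +
            commutator (offDiag (Complex.I • onVec X v)) (offDiag (Complex.I • onVec Y v)) +
            commutator KX KY) =
          TX.mapMatrix (offDiag (Complex.I • onVec Y v) + KY) -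
            TY.mapMatrix (offDiag (Complex.I • onVec X v) + KX) +
            commutator (offDiag (Complex.I • onVec X v) + KX)
              (offDiag (Complex.I • onVec Y v) + KY) := by
        rw [eo, map_add, map_add, mapMatrix_offDiag hTX.derivation,
          mapMatrix_offDiag hTY.derivation, commutator_add, add_commutator, add_commutator,
          commutator_swap (offDiag (Complex.I • onVec Y v)) KX]
        abel
      -- Commuting TX and TY past ∇ costs brackets with TX v and TY v, which the Leibniz rule on
      -- [W_X, W_Y] compensates exactly.
      have e₁ := mapMatrix_covDeriv hTX v 1 0 (offDiag (Complex.I • onVec Y v) + KY)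
      have e₂ := mapMatrix_covDeriv hTY v 1 0 (offDiag (Complex.I • onVec X v) + KX)
      rw [hKY.covDeriv_one_zero hD, mapMatrix_offDiag hTX.derivation, one_smul] at e₁
      rw [hKX.covDeriv_one_zero hD, mapMatrix_offDiag hTY.derivation, one_smul,
        commutator_swap] at e₂
      rw [eW, map_add, map_sub, map_commutator _ (covDeriv_mul hD v 1 0),
        hKX.covDeriv_one_zero hD, hKY.covDeriv_one_zero hD, bracket, offDiag_sub]
      linear_combination (norm := abel) e₂ - e₁

end Symplectic

/-! ### Unitary rotations of row vectors. -/

section Rotation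

variable {𝒜 : Type*} [NonUnitalCommRing 𝒜] [Module ℂ 𝒜] {n : ℕ}

theorem sum_mul_star_of_unitary {U : Matrix (Fin n) (Fin n) ℂ}
    (hU : U ∈ Matrix.unitaryGroup (Fin n) ℂ) (m l : Fin n) :
    ∑ j, U m j * star (U l j) = if m = l then 1 else 0 := by
  have := congrFun (congrFun ((Matrix.mem_unitaryGroup_iff).1 hU) m) l
  simpa [mul_apply, one_apply] using this

theorem rotate_star_rotate {U : Matrix (Fin n) (Fin n) ℂ}
    (hU : U ∈ Matrix.unitaryGroup (Fin n) ℂ) (a : Fin n → 𝒜) :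
    rotate (star U) (rotate U a) = a := by
  ext j
  simp only [rotate, Finset.smul_sum, smul_smul, star_apply]
  rw [Finset.sum_comm]
  simp only [← Finset.sum_smul, mul_comm (star _), sum_mul_star_of_unitary hU]
  simp

theorem opI_rotate_iff (a w : Fin n → 𝒜) {U : Matrix (Fin n) (Fin n) ℂ}
    (hU : U ∈ Matrix.unitaryGroup (Fin n) ℂ) : opI (rotate U a) (rotate U w) ↔ opI a w := by
  have h : Complex.I • rotate U a = rotate U (Complex.I • a) := by
    ext j
    simp [rotate, Finset.smul_sum, smul_comm Complex.I]
  rw [opI, opI, h]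
  exact (Function.LeftInverse.injective (rotate_star_rotate hU)).eq_iff

end Rotation

/-! ### Compatibility of the symplectic pair, and U(n)-equivariance of ℋ. -/

section Invariance

variable {𝒜 : Type*} [NonUnitalCommRing 𝒜] [StarRing 𝒜] [Module ℂ 𝒜] [IsScalarTower ℂ 𝒜 𝒜]
  [SMulCommClass ℂ 𝒜 𝒜] [StarModule ℂ 𝒜] {n : ℕ}

theorem areCompatibleSymplectic_opJ {D : 𝒜 →ₗ[ℂ] 𝒜} (hD : IsStarDerivation D)
    (h0 : ∀ f, D f = 0 → f = 0) (v : Fin n → 𝒜) :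
    AreCompatibleSymplectic D v (opJ D v) (inv opI) where
  left := isSymplectic_opJ hD h0 v
  right := inv_opI (𝒜 := 𝒜) ▸ isSymplectic_opNegI D v
  pencil c₁ c₂ := inv_opI (𝒜 := 𝒜) ▸
    (isSymplectic_opJ hD h0 v).pencil (isSymplectic_opNegI D v) c₁ c₂
  hereditary := by
    have h : comp (inv (inv opI)) (opJ D v) = opR D v := (opR_eq_comp D v).symm
    rw [h]
    exact isHereditary_opR hD h0 v

theorem vecMulVec_rotate (U : Matrix (Fin n) (Fin n) ℂ) (a b : Fin n → 𝒜) (j k : Fin n) :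
    vecMulVec (star (rotate U a)) (rotate U b) j k =
      ∑ l, ∑ m, (star (U l j) * U m k) • vecMulVec (star a) b l m := by
  simp only [vecMulVec_apply, Pi.star_apply, rotate, star_sum, star_smul, Finset.sum_mul_sum,
    smul_mul_smul_comm]

theorem opH_rotate {D : 𝒜 →ₗ[ℂ] 𝒜} (h0 : ∀ f, D f = 0 → f = 0) {v a w : Fin n → 𝒜}
    {U : Matrix (Fin n) (Fin n) ℂ} (hU : U ∈ Matrix.unitaryGroup (Fin n) ℂ)
    (h : opH D v a w) : opH D (rotate U v) (rotate U a) (rotate U w) := by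
  rw [opH_iff_wedge h0] at h ⊢
  obtain ⟨Q, hQ, rfl⟩ := h
  have hQ' : ∀ l m, D (Q l m) = wedgeH (star v) a l m := fun l m => congrFun (congrFun hQ l) m
  -- The antiderivative transforms by conjugation: this is U† Q U, with complex scalars acting on 𝒜.
  refine ⟨of fun j k => ∑ l, ∑ m, (star (U l j) * U m k) • Q l m, ?_, ?_⟩
  · ext j k
    simp only [map_apply, of_apply, map_sum, map_smul, hQ', wedgeH, Matrix.sub_apply, star_star,
      vecMulVec_rotate, smul_sub, Finset.sum_sub_distrib]
  · have htr : trace (of fun j k => ∑ l, ∑ m, (star (U l j) * U m k) • Q l m) = trace Q := by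
      simp only [trace, diag_apply, of_apply]
      rw [Finset.sum_comm]
      refine Finset.sum_congr rfl fun l _ => ?_
      rw [Finset.sum_comm]
      simp only [← Finset.sum_smul, mul_comm (star _), sum_mul_star_of_unitary hU]
      simp
    have hvec : ∀ k, (rotate U v ᵥ* of fun j k => ∑ l, ∑ m, (star (U l j) * U m k) • Q l m) k =
        rotate U (v ᵥ* Q) k := by
      intro k
      have h₁ : ∀ j, ∑ l, ∑ m, (star (U l j) * U m k) • Q l m =
          ∑ l, star (U l j) • ∑ m, U m k • Q l m := by
        intro j
        simp only [Finset.smul_sum, smul_smul]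
      simp only [vecMul, dotProduct, of_apply, h₁]
      generalize hR : (fun l => ∑ m, U m k • Q l m) = R
      have hR' : ∀ l, ∑ m, U m k • Q l m = R l := fun l => congrFun hR l
      simp only [hR']
      have h₂ : ∑ j, rotate U v j * ∑ l, star (U l j) • R l = ∑ l, v l * R l := by
        simp only [rotate, Finset.sum_mul_sum, smul_mul_smul_comm]
        rw [Finset.sum_comm]
        refine Finset.sum_congr rfl fun p _ => ?_
        rw [Finset.sum_comm]
        simp only [← Finset.sum_smul, sum_mul_star_of_unitary hU]
        simp
      rw [h₂]
      simp only [rotate, vecMul, dotProduct, ← hR', Finset.mul_sum, Finset.smul_sum, mul_smul_comm]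
      rw [Finset.sum_comm]
    rw [htr]
    ext k
    rw [hvec]
    simp only [rotate, smul_add, Finset.sum_add_distrib, map_sum, map_smul, Finset.mul_sum,
      mul_smul_comm]

theorem opH_rotate_iff {D : 𝒜 →ₗ[ℂ] 𝒜} (h0 : ∀ f, D f = 0 → f = 0) (v a w : Fin n → 𝒜)
    {U : Matrix (Fin n) (Fin n) ℂ} (hU : U ∈ Matrix.unitaryGroup (Fin n) ℂ) :
    opH D (rotate U v) (rotate U a) (rotate U w) ↔ opH D v a w := by
  refine ⟨fun h => ?_, opH_rotate h0 hU⟩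
  simpa only [rotate_star_rotate hU] using opH_rotate h0 (Unitary.star_mem hU) h

end Invariance

/-! ### Maurer–Cartan forms -/

section Determinant

variable {R : Type*} [CommRing R] [Module ℂ R] {ι : Type*} [DecidableEq ι]

/-- The Leibniz rule is written with an if-then-else so as to match the entries of `updateCol` in
Jacobi's formula. -/
theorem derivation_prod {D : R →ₗ[ℂ] R} (hD : ∀ f g, D (f * g) = D f * g + f * D g)
    (s : Finset ι) (f : ι → R) :
    D (∏ i ∈ s, f i) = ∑ i ∈ s, ∏ j ∈ s, if j = i then D (f j) else f j := by
  induction s using Finset.induction_on with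
  | empty =>
    have := hD 1 1
    simp only [mul_one, one_mul] at this
    simpa using this
  | insert a s ha ih =>
    rw [Finset.prod_insert ha, hD, ih, Finset.sum_insert ha, Finset.prod_insert ha, if_pos rfl,
      Finset.mul_sum]
    congr 1
    · congr 1
      refine Finset.prod_congr rfl fun j hj => ?_
      rw [if_neg (ne_of_mem_of_not_mem hj ha)]
    · refine Finset.sum_congr rfl fun i hi => ?_
      rw [Finset.prod_insert ha, if_neg (ne_of_mem_of_not_mem hi ha).symm]

/-- Jacobi's formula for the derivative of a determinant. -/
theorem derivation_det [Fintype ι] {D : R →ₗ[ℂ] R} (hD : ∀ f g, D (f * g) = D f * g + f * D g)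
    (g : Matrix ι ι R) : D g.det = trace (g.adjugate * g.map D) := by
  -- Cramer's rule: each diagonal entry is a determinant with one column differentiated.
  have h : trace (g.adjugate * g.map D) = ∑ i, (g.updateCol i fun k => D (g k i)).det := by
    refine Finset.sum_congr rfl fun i _ => ?_
    rw [← cramer_apply, cramer_eq_adjugate_mulVec]
    rfl
  rw [h, det_apply, map_sum]
  simp only [det_apply, updateCol_apply]
  rw [Finset.sum_comm]
  refine Finset.sum_congr rfl fun σ _ => ?_
  rw [← Finset.smul_sum, Units.smul_def, Units.smul_def, map_zsmul, derivation_prod hD]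
  congr 1
  refine Finset.sum_congr rfl fun i _ => Finset.prod_congr rfl fun j _ => ?_
  split_ifs with hj
  · rw [hj]
  · rfl

end Determinant

/-! ### Directional derivatives on smooth functions: commuting star derivations. -/

section Smooth

variable {Ω : TopologicalSpace.Opens (ℝ × ℝ)}

theorem dir_apply (e : ℝ × ℝ) (f : Smooth Ω) (p : Ω) :
    (dir Ω e f : Ω → ℂ) p = fderiv ℝ (extendZero Ω f) p e := rfl

theorem isStarDerivation_dir (e : ℝ × ℝ) : IsStarDerivation (dir Ω e) where
  leibniz f g := by
    ext p
    have h : extendZero Ω ((f * g : Smooth Ω) : Ω → ℂ) = extendZero Ω f * extendZero Ω g := by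
      ext q; by_cases hq : q ∈ Ω <;> simp [extendZero, hq]
    rw [dir_apply, h, fderiv_mul (smooth_differentiableAt f p) (smooth_differentiableAt g p)]
    simp [dir_apply, extendZero_of_mem _ p.2]
    ring
  map_star f := by
    ext p
    have h : extendZero Ω ((star f : Smooth Ω) : Ω → ℂ) =
        Complex.conjCLE ∘ extendZero Ω f := by
      ext q; by_cases hq : q ∈ Ω <;> simp [extendZero, hq]
    rw [dir_apply, h, ContinuousLinearEquiv.comp_fderiv]
    simp [dir_apply]

theorem dir_comm (e e' : ℝ × ℝ) (f : Smooth Ω) : dir Ω e (dir Ω e' f) = dir Ω e' (dir Ω e f) := by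
  ext p
  have hf : ContDiffAt ℝ ∞ (extendZero Ω f) (p : ℝ × ℝ) :=
    f.2.contDiffAt (Ω.isOpen.mem_nhds p.2)
  have hd : DifferentiableAt ℝ (fderiv ℝ (extendZero Ω f)) (p : ℝ × ℝ) :=
    (hf.fderiv_right (m := ∞) (by simp)).differentiableAt (by simp)
  have key : ∀ e e' : ℝ × ℝ, (dir Ω e (dir Ω e' f) : Ω → ℂ) p =
      fderiv ℝ (fderiv ℝ (extendZero Ω f)) p e e' := by
    intro e e'
    -- Equality is claimed only near p: no regularity of the zero extension is known at the boundary
    -- of Ω.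
    have h : extendZero Ω (dir Ω e' f : Ω → ℂ) =ᶠ[nhds (p : ℝ × ℝ)]
        fun q => fderiv ℝ (extendZero Ω f) q e' := by
      filter_upwards [Ω.isOpen.mem_nhds p.2] with q hq
      rw [extendZero_of_mem _ hq, dir_apply]
    rw [dir_apply, h.fderiv_eq, fderiv_clm_apply hd (differentiableAt_const _)]
    simp
  rw [key, key]
  exact hf.isSymmSndFDerivAt (by
    rw [minSmoothness_of_isRCLikeNormedField]
    exact WithTop.coe_le_coe.2 (le_top : (2 : ℕ∞) ≤ ⊤)) e e'

theorem isEvolutionary_dir (e e' : ℝ × ℝ) : IsEvolutionary (dir Ω e) (dir Ω e') :=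
  ⟨isStarDerivation_dir e', dir_comm e' e⟩

end Smooth

/-! ### Maurer–Cartan forms and the structure equations of a pair. -/

section MaurerCartan

variable {R : Type*} [CommRing R] [StarRing R] [Algebra ℂ R] {n : ℕ} {D E : R →ₗ[ℂ] R}
  {g g₁ g₂ : BlockMat R n}

theorem conjTranspose_mul_self_of_mem {R ι : Type*} [CommRing R] [StarRing R] [Fintype ι]
    [DecidableEq ι] {g : Matrix ι ι R} (hg : g ∈ unitaryGroup ι R) : gᴴ * g = 1 :=
  mem_unitaryGroup_iff'.1 hg

theorem mul_conjTranspose_self_of_mem {R ι : Type*} [CommRing R] [StarRing R] [Fintype ι]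
    [DecidableEq ι] {g : Matrix ι ι R} (hg : g ∈ unitaryGroup ι R) : g * gᴴ = 1 :=
  mem_unitaryGroup_iff.1 hg

/-- The component of `g⁻¹ dg` along the derivation `D`, for unitary `g`. -/
def maurerCartanForm (D : R →ₗ[ℂ] R) (g : BlockMat R n) : BlockMat R n := gᴴ * D.mapMatrix g

theorem IsStarDerivation.map_one (hD : IsStarDerivation D) : D 1 = 0 := by
  simpa using hD.leibniz 1 1

theorem mapMatrix_conjTranspose_of_unitary (hD : IsStarDerivation D)
    (hg : g ∈ unitaryGroup (Fin 1 ⊕ Fin n) R) :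
    D.mapMatrix gᴴ = -(maurerCartanForm D g * gᴴ) := by
  have h := congrArg D.mapMatrix (conjTranspose_mul_self_of_mem hg)
  have hone : D.mapMatrix (1 : BlockMat R n) = 0 := by
    ext i j
    by_cases hij : i = j <;> simp [one_apply, hij, hD.map_one]
  rw [mapMatrix_mul hD, hone] at h
  calc D.mapMatrix gᴴ = D.mapMatrix gᴴ * g * gᴴ := by
        rw [mul_assoc, mul_conjTranspose_self_of_mem hg, mul_one]
    _ = -(maurerCartanForm D g * gᴴ) := by
      rw [eq_neg_of_add_eq_zero_left h, neg_mul, maurerCartanForm]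

theorem conjTranspose_maurerCartanForm (hD : IsStarDerivation D)
    (hg : g ∈ unitaryGroup (Fin 1 ⊕ Fin n) R) :
    (maurerCartanForm D g)ᴴ = -maurerCartanForm D g := by
  have h : (D.mapMatrix g)ᴴ = D.mapMatrix gᴴ := by
    ext i j; simp [hD.map_star]
  rw [maurerCartanForm, conjTranspose_mul, conjTranspose_conjTranspose, h,
    mapMatrix_conjTranspose_of_unitary hD hg, neg_mul, mul_assoc,
    conjTranspose_mul_self_of_mem hg, mul_one, maurerCartanForm]

/-- The Maurer–Cartan structure equation. -/
theorem maurerCartanForm_structure (hD : IsStarDerivation D) (hE : IsEvolutionary D E)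
    (hg : g ∈ unitaryGroup (Fin 1 ⊕ Fin n) R) :
    E.mapMatrix (maurerCartanForm D g) - D.mapMatrix (maurerCartanForm E g) =
      commutator (maurerCartanForm D g) (maurerCartanForm E g) := by
  have hd := mapMatrix_conjTranspose_of_unitary hD hg
  have he := mapMatrix_conjTranspose_of_unitary hE.derivation hg
  simp only [maurerCartanForm] at hd he ⊢
  rw [mapMatrix_mul hE.derivation, mapMatrix_mul hD, hd, he, mapMatrix_comm hE, commutator]
  simp only [neg_mul, mul_assoc]
  abel

/-- With det g = 1 the adjugate is gᴴ, so Jacobi's formula gives D(1) = 0. -/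
theorem trace_maurerCartanForm (hD : IsStarDerivation D)
    (hg : g ∈ specialUnitaryGroup (Fin 1 ⊕ Fin n) R) : trace (maurerCartanForm D g) = 0 := by
  obtain ⟨hu, hdet⟩ := mem_specialUnitaryGroup_iff.1 hg
  have hadj : g.adjugate = gᴴ := by
    calc g.adjugate = g.adjugate * (g * gᴴ) := by
          rw [mul_conjTranspose_self_of_mem hu, mul_one]
      _ = gᴴ := by rw [← mul_assoc, adjugate_mul, hdet, one_smul, one_mul]
  rw [maurerCartanForm, ← hadj, LinearMap.mapMatrix_apply, ← derivation_det hD.leibniz, hdet,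
    hD.map_one]

/-- The antisymmetric part of the Maurer–Cartan form of a pair. -/
def coframeForm (D : R →ₗ[ℂ] R) (g₁ g₂ : BlockMat R n) : BlockMat R n :=
  (1 / 2 : ℂ) • (maurerCartanForm D g₁ - maurerCartanForm D g₂)

/-- The symmetric part of the Maurer–Cartan form of a pair. -/
def connectionForm (D : R →ₗ[ℂ] R) (g₁ g₂ : BlockMat R n) : BlockMat R n :=
  (1 / 2 : ℂ) • (maurerCartanForm D g₁ + maurerCartanForm D g₂)

theorem coframeForm_structure (hD : IsStarDerivation D) (hE : IsEvolutionary D E)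
    (h₁ : g₁ ∈ unitaryGroup (Fin 1 ⊕ Fin n) R) (h₂ : g₂ ∈ unitaryGroup (Fin 1 ⊕ Fin n) R) :
    E.mapMatrix (coframeForm D g₁ g₂) - D.mapMatrix (coframeForm E g₁ g₂) =
      commutator (connectionForm D g₁ g₂) (coframeForm E g₁ g₂) +
        commutator (coframeForm D g₁ g₂) (connectionForm E g₁ g₂) := by
  have e₁ := maurerCartanForm_structure hD hE h₁
  have e₂ := maurerCartanForm_structure hD hE h₂
  simp only [coframeForm, connectionForm, map_smul, map_sub, commutator_smul, smul_commutator,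
    sub_commutator, add_commutator, commutator_sub, commutator_add]
  linear_combination (norm := module) (1 / 2 : ℂ) • e₁ - (1 / 2 : ℂ) • e₂

theorem connectionForm_structure (hD : IsStarDerivation D) (hE : IsEvolutionary D E)
    (h₁ : g₁ ∈ unitaryGroup (Fin 1 ⊕ Fin n) R) (h₂ : g₂ ∈ unitaryGroup (Fin 1 ⊕ Fin n) R) :
    E.mapMatrix (connectionForm D g₁ g₂) - D.mapMatrix (connectionForm E g₁ g₂) =
      commutator (connectionForm D g₁ g₂) (connectionForm E g₁ g₂) +
        commutator (coframeForm D g₁ g₂) (coframeForm E g₁ g₂) := by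
  have e₁ := maurerCartanForm_structure hD hE h₁
  have e₂ := maurerCartanForm_structure hD hE h₂
  simp only [coframeForm, connectionForm, map_smul, map_add, commutator_smul, smul_commutator,
    sub_commutator, add_commutator, commutator_sub, commutator_add]
  linear_combination (norm := module) (1 / 2 : ℂ) • e₁ + (1 / 2 : ℂ) • e₂

end MaurerCartan

/-! ### The constant tangent direction e_x and its adjoint action. -/

section Tangent

variable {R : Type*} [CommRing R] [Algebra ℂ R] {n : ℕ}

/-- The diagonal matrix `diag(-n, 1, …, 1)`. -/
def tangentDiag (R : Type*) [CommRing R] [Algebra ℂ R] (n : ℕ) : BlockMat R n :=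
  fromBlocks (-((n : ℂ) • 1)) 0 0 1

/-- The eigenvalues -n and 1 differ by n + 1, which cancels the denominator; thus ad(e_x) acts as
-κi on the upper right block. -/
theorem commutator_tangentDiag (M : BlockMat R n) :
    commutator ((Complex.I / ((n : ℂ) + 1)) • tangentDiag R n) M = -quarterTurn M := by
  have hn : (n : ℂ) + 1 ≠ 0 := Nat.cast_add_one_ne_zero n
  have hI : (Complex.I / ((n : ℂ) + 1)) * ((n : ℂ) + 1) = Complex.I := div_mul_cancel₀ _ hn
  have h : commutator (tangentDiag R n) M = ((n : ℂ) + 1) •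
      fromBlocks 0 (-M.toBlocks₁₂) M.toBlocks₂₁ 0 := by
    conv_lhs => rw [← fromBlocks_toBlocks M]
    rw [commutator, tangentDiag, fromBlocks_multiply, fromBlocks_multiply, sub_eq_add_neg,
      fromBlocks_neg, fromBlocks_add, fromBlocks_smul]
    congr 1
    · simp
    · simp [add_smul, add_comm]
    · simp [add_smul, add_comm]
    · simp
  rw [smul_commutator, h, smul_smul, hI, quarterTurn_apply, fromBlocks_smul, fromBlocks_neg]
  simp

theorem trace_tangentDiag_mul_self :
    trace (tangentDiag R n * tangentDiag R n) = ((n : ℂ) * ((n : ℂ) + 1)) • (1 : R) := by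
  rw [tangentDiag, fromBlocks_multiply, trace_fromBlocks]
  simp only [neg_mul_neg, Matrix.mul_smul, mul_one, Matrix.mul_zero, add_zero, zero_add,
    trace_smul, trace_one, Fintype.card_fin, smul_smul, mul_add, add_smul]
  simp [Algebra.smul_def]

theorem tracelessDiag_smul (c : ℂ) (Q : Matrix (Fin n) (Fin n) R) :
    tracelessDiag (c • Q) = c • tracelessDiag Q := by
  rw [tracelessDiag, tracelessDiag, fromBlocks_smul, trace_smul]
  congr 1
  · ext i j; simp
  · simp
  · simp

end Tangent

/-! ### The flow equation over an abstract ring with two commuting derivations. -/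

section FlowEquation

variable {R : Type*} [CommRing R] [StarRing R] [Algebra ℂ R] {n : ℕ} {D E : R →ₗ[ℂ] R}
  {g₁ g₂ : BlockMat R n}

theorem conjTranspose_coframeForm [StarModule ℂ R] (hD : IsStarDerivation D)
    (h₁ : g₁ ∈ unitaryGroup (Fin 1 ⊕ Fin n) R) (h₂ : g₂ ∈ unitaryGroup (Fin 1 ⊕ Fin n) R) :
    (coframeForm D g₁ g₂)ᴴ = -coframeForm D g₁ g₂ := by
  rw [coframeForm, conjTranspose_smul, conjTranspose_sub, conjTranspose_maurerCartanForm hD h₁,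
    conjTranspose_maurerCartanForm hD h₂, ← smul_neg]
  simp [sub_eq_add_neg, add_comm]

theorem conjTranspose_connectionForm [StarModule ℂ R] (hD : IsStarDerivation D)
    (h₁ : g₁ ∈ unitaryGroup (Fin 1 ⊕ Fin n) R) (h₂ : g₂ ∈ unitaryGroup (Fin 1 ⊕ Fin n) R) :
    (connectionForm D g₁ g₂)ᴴ = -connectionForm D g₁ g₂ := by
  rw [connectionForm, conjTranspose_smul, conjTranspose_add, conjTranspose_maurerCartanForm hD h₁,
    conjTranspose_maurerCartanForm hD h₂, ← smul_neg]
  simp [add_comm]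

theorem trace_coframeForm (hD : IsStarDerivation D)
    (h₁ : g₁ ∈ specialUnitaryGroup (Fin 1 ⊕ Fin n) R)
    (h₂ : g₂ ∈ specialUnitaryGroup (Fin 1 ⊕ Fin n) R) : trace (coframeForm D g₁ g₂) = 0 := by
  rw [coframeForm, trace_smul, trace_sub, trace_maurerCartanForm hD h₁,
    trace_maurerCartanForm hD h₂, sub_zero, smul_zero]

theorem trace_connectionForm (hD : IsStarDerivation D)
    (h₁ : g₁ ∈ specialUnitaryGroup (Fin 1 ⊕ Fin n) R)
    (h₂ : g₂ ∈ specialUnitaryGroup (Fin 1 ⊕ Fin n) R) : trace (connectionForm D g₁ g₂) = 0 := by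
  rw [connectionForm, trace_smul, trace_add, trace_maurerCartanForm hD h₁,
    trace_maurerCartanForm hD h₂, add_zero, smul_zero]

theorem mapMatrix_tangentDiag (hD : IsStarDerivation D) : D.mapMatrix (tangentDiag R n) = 0 := by
  ext i j
  rcases i with i | i <;> rcases j with j | j
  · simp [tangentDiag, one_apply, Subsingleton.elim i j, hD.map_one]
  · simp [tangentDiag]
  · simp [tangentDiag]
  · by_cases hij : i = j <;> simp [tangentDiag, one_apply, hij, hD.map_one]

variable {κ : ℝ} {v h ϖ : Fin n → R} {hb Θ : Matrix (Fin n) (Fin n) R}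

/-- tr diag(-n, 1, …, 1)² = n(n + 1), so the arclength condition reads κ² n / (2(n + 1)) = 1;
nontriviality of R allows it to be read in ℂ. -/
theorem sq_eq_of_arclength [Nontrivial R] (hn : 1 ≤ n)
    (htangent : coframeForm D g₁ g₂ =
      ((κ : ℂ) * Complex.I / ((n : ℂ) + 1)) • tangentDiag R n)
    (harc : (-(1 / 2) : ℂ) • trace (coframeForm D g₁ g₂ * coframeForm D g₁ g₂) = 1) :
    κ ^ 2 = 2 * ((n : ℝ) + 1) / n := by
  have hn₀ : (n : ℝ) ≠ 0 := Nat.cast_ne_zero.2 (by omega)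
  have hn₁ : (n : ℂ) + 1 ≠ 0 := Nat.cast_add_one_ne_zero n
  rw [htangent, Matrix.smul_mul, Matrix.mul_smul, trace_smul, trace_smul,
    trace_tangentDiag_mul_self, smul_smul, smul_smul, smul_smul,
    ← Algebra.algebraMap_eq_smul_one, ← map_one (algebraMap ℂ R)] at harc
  have h := (algebraMap ℂ R).injective harc
  have hI : Complex.I ^ 2 = -1 := Complex.I_sq
  field_simp at h
  rw [hI] at h
  rw [eq_div_iff hn₀]
  have h' : (κ : ℂ) ^ 2 * n = 2 * ((n : ℂ) + 1) := by linear_combination h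
  exact_mod_cast h'

theorem IsValueH.neg {a w : Fin n → R} {s : R} {Q : Matrix (Fin n) (Fin n) R}
    (H : IsValueH D v a s Q w) : IsValueH D v (-a) (-s) (-Q) (-w) where
  antideriv_dot := by rw [map_neg, H.antideriv_dot, smul_neg, dotH_neg]
  antideriv_wedge := by
    have h₁ : (-Q).map D = -Q.map D := by ext i j; simp
    rw [h₁, H.antideriv_wedge]
    simp [wedgeH, sub_eq_add_neg, add_comm]
  value := by
    rw [H.value, vecMul_neg]
    ext j
    simp [onVec]
    ring

variable [StarModule ℂ R]

/-- A lift with traceless diagonal part gives a value of `ℋ`, even if `D` has a kernel. -/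
theorem IsLift.isValueH {a w : Fin n → R} {Q : Matrix (Fin n) (Fin n) R}
    (hL : IsLift D v a w (tracelessDiag Q)) : IsValueH D v a ((Complex.I / 2) • Q.trace) Q w := by
  refine isValueH_of_wedge ?_ ?_
  · simpa [tracelessDiag] using toBlocks₂₂_map_eq_wedgeH hL.antideriv
  · have := hL.value
    rw [commutator, offDiag, offDiag, offDiag, tracelessDiag, fromBlocks_multiply,
      fromBlocks_multiply] at this
    ext j
    have := congrFun (congrFun this (Sum.inl 0)) (Sum.inr j)
    simp [mul_apply, onVec] at this
    simp [← this, vecMul, dotProduct]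
    ring

/-- The structure equations of the coframe and connection of a parallel curve flow. -/
theorem isLift_of_parallel (hD : IsStarDerivation D) (hE : IsEvolutionary D E)
    (h₁ : g₁ ∈ specialUnitaryGroup (Fin 1 ⊕ Fin n) R)
    (h₂ : g₂ ∈ specialUnitaryGroup (Fin 1 ⊕ Fin n) R) (hκ : κ ≠ 0)
    (htangent : coframeForm D g₁ g₂ =
      ((κ : ℂ) * Complex.I / ((n : ℂ) + 1)) • tangentDiag R n)
    (hparallel : connectionForm D g₁ g₂ = offDiag v)
    (hnormal : (coframeForm E g₁ g₂).toBlocks₁₂ = (κ : ℂ) • replicateRow (Fin 1) h)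
    (hcentral : (coframeForm E g₁ g₂).toBlocks₂₂ = (κ : ℂ) • hb)
    (hconn_normal : (connectionForm E g₁ g₂).toBlocks₁₂ = replicateRow (Fin 1) ϖ)
    (hconn_central : (connectionForm E g₁ g₂).toBlocks₂₂ = Θ) :
    IsLift D v h (Complex.I • ϖ) (tracelessDiag hb) ∧
      IsLift D v ϖ (onVec E v + ((κ ^ 2 : ℝ) : ℂ) • (Complex.I • h)) (tracelessDiag Θ) := by
  have u₁ := (mem_specialUnitaryGroup_iff.1 h₁).1
  have u₂ := (mem_specialUnitaryGroup_iff.1 h₂).1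
  have hκ' : (κ : ℂ) ≠ 0 := Complex.ofReal_ne_zero.2 hκ
  have et : coframeForm E g₁ g₂ = (κ : ℂ) • (offDiag h + tracelessDiag hb) := by
    rw [smul_add, ← offDiag_smul, ← tracelessDiag_smul]
    exact eq_offDiag_add_tracelessDiag (conjTranspose_coframeForm hE.derivation u₁ u₂)
      (trace_coframeForm hE.derivation h₁ h₂) hnormal hcentral
  have ωt : connectionForm E g₁ g₂ = offDiag ϖ + tracelessDiag Θ :=
    eq_offDiag_add_tracelessDiag (conjTranspose_connectionForm hE.derivation u₁ u₂)
      (trace_connectionForm hE.derivation h₁ h₂) hconn_normal hconn_central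
  have ex : coframeForm D g₁ g₂ = (κ : ℂ) • ((Complex.I / ((n : ℂ) + 1)) • tangentDiag R n) := by
    rw [htangent, smul_smul, mul_div_assoc]
  have s₁ := coframeForm_structure hD hE u₁ u₂
  have s₂ := connectionForm_structure hD hE u₁ u₂
  have hq : ∀ (a : Fin n → R) (Q : Matrix (Fin n) (Fin n) R),
      quarterTurn (offDiag a + tracelessDiag Q) = offDiag (Complex.I • a) := by
    intro a Q
    rw [map_add, quarterTurn_of_diag (isBlockDiag_tracelessDiag Q), quarterTurn_offDiag, add_zero]
  rw [et, ωt, ex, hparallel, smul_commutator, commutator_tangentDiag, hq, commutator_smul,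
    map_smul, map_smul, map_smul, mapMatrix_tangentDiag hE.derivation] at s₁
  rw [et, ωt, ex, hparallel, smul_commutator, commutator_smul, commutator_tangentDiag, hq,
    mapMatrix_offDiag hE.derivation, smul_smul] at s₂
  constructor
  · refine isLift_of_covariant hD (isBlockDiag_tracelessDiag hb) ?_
    -- Both e_t and the bracket [e_x, ω_t] carry a factor κ, which is cancelled here.
    refine smul_right_injective _ hκ' ?_
    simp only
    linear_combination (norm := module) -s₁
  · refine isLift_of_covariant hD (isBlockDiag_tracelessDiag Θ) ?_
    rw [offDiag_add, offDiag_smul]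
    push_cast
    linear_combination (norm := module) -s₂

/-- The flow equation in terms of the operators `ℋ`, `𝒥` and `ℛ`, from its lifted form. -/
theorem flow_equation_of_isLift {w : Fin n → R}
    (H₁ : IsLift D v h (Complex.I • ϖ) (tracelessDiag hb))
    (H₂ : IsLift D v ϖ w (tracelessDiag Θ)) :
    IsValueJ D v (Complex.I • h) ((Complex.I / 2) • hb.trace) (Complex.I • hb) (-ϖ) ∧
      (∃ u, IsValueH D v h ((Complex.I / 2) • hb.trace) hb u ∧ -ϖ = Complex.I • u) ∧
      IsValueH D v ϖ ((Complex.I / 2) • Θ.trace) Θ w ∧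
      IsValueR D v (Complex.I • h) (-((Complex.I / 2) • hb.trace)) (-hb) (-(Complex.I • ϖ)) ∧
      IsValueR D v (-(Complex.I • ϖ)) ((Complex.I / 2) • Θ.trace) Θ w ∧
      comp (opR D v) (opR D v) (Complex.I • h) w := by
  have V₁ := H₁.isValueH
  have V₂ := H₂.isValueH
  have hϖ : Complex.I • -(Complex.I • ϖ) = ϖ := by rw [smul_neg, I_smul_I_smul, neg_neg]
  have R₁ : IsValueR D v (Complex.I • h) (-((Complex.I / 2) • hb.trace)) (-hb)
      (-(Complex.I • ϖ)) := by
    rw [IsValueR, I_smul_I_smul]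
    exact V₁.neg
  have R₂ : IsValueR D v (-(Complex.I • ϖ)) ((Complex.I / 2) • Θ.trace) Θ w := by
    rw [IsValueR, hϖ]
    exact V₂
  refine ⟨?_, ⟨_, V₁, (I_smul_I_smul ϖ).symm⟩, V₂, R₁, R₂,
    ⟨_, ⟨_, rfl, _, _, R₁⟩, ⟨_, rfl, _, _, R₂⟩⟩⟩
  rw [isValueJ_iff, I_smul_I_smul, smul_smul, Complex.I_mul_I, neg_one_smul, smul_neg]
  exact V₁.neg

end FlowEquation

/-! ### Specialisation to parallel curve flows on Ω. -/

section Smooth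

variable {Ω : TopologicalSpace.Opens (ℝ × ℝ)} {n : ℕ} {κ : ℝ} {γ g₁ g₂ : SmoothMat Ω n}
  {v h ϖ : Fin n → Smooth Ω} {hb Θ : Matrix (Fin n) (Fin n) (Smooth Ω)}

theorem nontrivial_smooth (hΩ : (Ω : Set (ℝ × ℝ)).Nonempty) : Nontrivial (Smooth Ω) := by
  obtain ⟨p, hp⟩ := hΩ
  refine ⟨0, 1, fun h => ?_⟩
  have := congrFun (congrArg Subtype.val h) ⟨p, hp⟩
  simp at this

theorem IsParallelCurveFlow.sq_eq (H : IsParallelCurveFlow κ γ g₁ g₂ v h ϖ hb Θ)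
    (hΩ : (Ω : Set (ℝ × ℝ)).Nonempty) (hn : 1 ≤ n) : κ ^ 2 = 2 * ((n : ℝ) + 1) / n := by
  have := nontrivial_smooth hΩ
  exact sq_eq_of_arclength (D := Dx Ω) (g₁ := g₁) (g₂ := g₂) hn H.tangent H.arclength

theorem IsParallelCurveFlow.isLift (H : IsParallelCurveFlow κ γ g₁ g₂ v h ϖ hb Θ)
    (hκ : κ ≠ 0) :
    IsLift (Dx Ω) v h (Complex.I • ϖ) (tracelessDiag hb) ∧
      IsLift (Dx Ω) v ϖ (onVec (Dt Ω) v + ((κ ^ 2 : ℝ) : ℂ) • (Complex.I • h))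
        (tracelessDiag Θ) :=
  isLift_of_parallel (isStarDerivation_dir _) (isEvolutionary_dir _ _) H.mem₁ H.mem₂ hκ H.tangent
    H.parallel H.normal H.central H.conn_normal H.conn_central

end Smooth

end CurveFlow

end

/-! ### Assembly of the theorem. -/

open CurveFlow in
theorem theorem1 (n : ℕ) (hn : 1 ≤ n) :
    -- the operators, in an arbitrary differential algebra in which `D_x⁻¹` is unambiguous
    (∀ (𝒜 : Type*) [NonUnitalCommRing 𝒜] [StarRing 𝒜] [Module ℂ 𝒜] [IsScalarTower ℂ 𝒜 𝒜]
        [SMulCommClass ℂ 𝒜 𝒜] [StarModule ℂ 𝒜] (D : 𝒜 →ₗ[ℂ] 𝒜),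
        IsStarDerivation D → (∀ f, D f = 0 → f = 0) →
      ∀ v : Fin n → 𝒜,
        -- `U(N-1)`-invariance
        (∀ U ∈ Matrix.unitaryGroup (Fin n) ℂ, ∀ a w,
          (opH D (rotate U v) (rotate U a) (rotate U w) ↔ opH D v a w) ∧
          (opI (rotate U a) (rotate U w) ↔ opI a w)) ∧
        IsHamiltonianPair D v (opH D v) opI ∧
        inv (opI (𝒜 := 𝒜) (n := n)) = opNegI ∧
        opJ D v = comp (inv opI) (comp (opH D v) opI) ∧
        AreCompatibleSymplectic D v (opJ D v) (inv opI) ∧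
        opR D v = comp (opH D v) opI ∧
        opR D v = comp opI (opJ D v) ∧
        IsHereditary D v (opR D v)) ∧
    -- the flow equation
    (∀ (Ω : TopologicalSpace.Opens (ℝ × ℝ)), (Ω : Set (ℝ × ℝ)).Nonempty →
      ∀ (κ : ℝ) (γ g₁ g₂ : SmoothMat Ω n) (v h ϖ : Fin n → Smooth Ω)
        (hb Θ : Matrix (Fin n) (Fin n) (Smooth Ω)),
        IsParallelCurveFlow κ γ g₁ g₂ v h ϖ hb Θ →
      ∀ χ : ℝ, χ = κ ^ 2 →
        χ = 2 * ((n : ℝ) + 1) / n ∧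
        -- `-ϖ = 𝒥(i h) = i ℋ(h)`
        IsValueJ (Dx Ω) v (Complex.I • h) ((Complex.I / 2) • hb.trace) (Complex.I • hb) (-ϖ) ∧
        (∃ u, IsValueH (Dx Ω) v h ((Complex.I / 2) • hb.trace) hb u ∧ -ϖ = Complex.I • u) ∧
        -- `v_t = ℋ(ϖ) - χ ℐ(h) = ℛ²(i h) - χ i h`
        ∃ w, IsValueH (Dx Ω) v ϖ ((Complex.I / 2) • Θ.trace) Θ w ∧
          IsValueR (Dx Ω) v (Complex.I • h) (-((Complex.I / 2) • hb.trace)) (-hb)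
            (-(Complex.I • ϖ)) ∧
          IsValueR (Dx Ω) v (-(Complex.I • ϖ)) ((Complex.I / 2) • Θ.trace) Θ w ∧
          comp (opR (Dx Ω) v) (opR (Dx Ω) v) (Complex.I • h) w ∧
          onVec (Dt Ω) v = w - (χ : ℂ) • (Complex.I • h)) := by
  refine ⟨?_, ?_⟩
  · intro 𝒜 _ _ _ _ _ _ D hD h0 v
    exact ⟨fun U hU a w => ⟨opH_rotate_iff h0 v a w hU, opI_rotate_iff a w hU⟩,
      isHamiltonianPair_opH_opI hD h0 v, inv_opI, opJ_eq_comp D v,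
      areCompatibleSymplectic_opJ hD h0 v, rfl, opR_eq_comp D v, isHereditary_opR hD h0 v⟩
  · rintro Ω hΩ κ γ g₁ g₂ v h ϖ hb Θ H _ rfl
    have hsq := H.sq_eq hΩ hn
    have hκ : κ ≠ 0 := by
      rintro rfl
      have : (0 : ℝ) < 2 * ((n : ℝ) + 1) / n := by
        have : (0 : ℝ) < n := Nat.cast_pos.2 hn
        positivity
      rw [← hsq] at this
      simp at this
    obtain ⟨H₁, H₂⟩ := H.isLift hκ
    obtain ⟨hJ, hH, hw, hR, hR', hRR⟩ := flow_equation_of_isLift H₁ H₂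
    -- The witness is w = v_t + χ i h, the value of ℋ(ϖ) read off from the second structure
    -- equation.
    exact ⟨hsq, hJ, hH, _, hw, hR, hR', hRR, (add_sub_cancel_right _ _).symm⟩
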